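/- Let $\mathbb{K}$ be a field and let $V, V'$ be vector spaces over $\mathbb{K}$ of finite positive dimension. Definitions. An eigenspace of $A\in\mathrm{End}(V)$ is a nonzero subspace of the form $\{v\in V : Av=\theta v\}$, $\theta\in\mathbb{K}$; $A$ is diagonalizable if $V$ is spanned by its eigenspaces. For $A,A^*\in\mathrm{End}(V)$, an ordering $V_0,\dots,V_d$ of the eigenspaces of $A$ is standard if $A^*V_i\subseteq V_{i-1}+V_i+V_{i+1}$ for $0\le i\le d$ (with $V_{-1}=V_{d+1}=0$); standard orderings $V^*_0,\dots,V^*_\delta$ of the eigenspaces of $A^*$ are defined in the same way with $A$ and $A^*$ exchanged. The pair $A,A^*$ is a tridiagonal pair on $V$ if $A$ and $A^*$ are diagonalizable, each has a standard ordering of its eigenspaces, and no subspace $W\ne 0,V$ satisfies $AW\subseteq W$ and $A^*W\subseteq W$. It is known that then $d=\delta$ (the diameter) and $\dim V_i=\dim V^*_i=:\rho_i$ for $0\le i\le d$; the pair is sharp if $\rho_0=1$. A tridiagonal system on $V$ is a sequence $\Phi=(A;\{E_i\}_{i=0}^d;A^*;\{E^*_i\}_{i=0}^d)$ where $A,A^*$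 is a tridiagonal pair and, for some standard orderings $\{V_i\}_{i=0}^d$, $\{V^*_i\}_{i=0}^d$ of the eigenspaces of $A$, $A^*$, the map $E_i$ (resp. $E^*_i$) is the projection onto $V_i$ (resp. $V^*_i$) that vanishes on all $V_j$ (resp. $V^*_j$) with $j\ne i$; it is said to be associated with the pair $A,A^*$, and it is sharp if this pair is. If $\Phi$ is sharp, let $\theta_i$ (resp. $\theta^*_i$) be the eigenvalue of $A$ on $E_iV$ (resp. of $A^*$ on $E^*_iV$), let $U_i=(E^*_0V+\cdots+E^*_iV)\cap(E_iV+\cdots+E_dV)$, and let $\zeta_i$ be the eigenvalue of $$(A^*-\theta^*_1I)(A^*-\theta^*_2I)\cdots(A^*-\theta^*_iI)(A-\theta_{i-1}I)\cdots(A-\theta_1I)(A-\theta_0I)$$ on the one-dimensional space $U_0$, which is invariant under this map. The parameter array of $\Phi$ is $(\{\theta_i\}_{i=0}^d;\{\theta^*_i\}_{i=0}^d;\{\zeta_i\}_{i=0}^d)$; it is defined only when $\Phi$ is sharp. A parameter array of a tridiagonal pair is the parameter array of a tridiagonal system associated with it. Tridiagonal pairs $A,A^*$ on $V$ and $A',A^{*\prime}$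 on $V'$ are isomorphic if there is a linear bijection $\gamma:V\to V'$ with $\gamma A=A'\gamma$ and $\gamma A^*=A^{*\prime}\gamma$; tridiagonal systems are isomorphic if they have the same diameter $d$ and there is such a $\gamma$ which moreover satisfies $\gamma E_i=E'_i\gamma$ and $\gamma E^*_i=E^{*\prime}_i\gamma$ for $0\le i\le d$. Theorem. (i) A sharp tridiagonal pair on $V$ and a sharp tridiagonal pair on $V'$ are isomorphic if and only if they have a parameter array in common. (ii) Assume that $\mathbb{K}$ is algebraically closed. Then a tridiagonal pair on $V$ and a tridiagonal pair on $V'$ (not assumed to be sharp) are isomorphic if and only if they have a parameter array in common. (iii) Assume that $\mathbb{K}$ is algebraically closed. Then a tridiagonal system on $V$ and a tridiagonal system on $V'$ (not assumed to be sharp) are isomorphic if and only if they have the same parameter array. -/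

import Mathlib

open Module

namespace Tridiagonal

section Pairs

variable {K : Type*} [Field K] {V : Type*} [AddCommGroup V] [Module K V]
variable {V' : Type*} [AddCommGroup V'] [Module K V']

/-- `W` is an eigenspace of `A`: `W ≠ 0` and `W = {v | A v = θ v}` for some scalar `θ`. -/
def IsEigenspace (A : End K V) (W : Submodule K V) : Prop :=
  W ≠ ⊥ ∧ ∃ θ : K, W = A.eigenspace θ

/-- `A` is diagonalizable: `V` is spanned by the eigenspaces of `A`. -/
def IsDiagonalizable (A : End K V) : Prop :=
  sSup {W : Submodule K V | IsEigenspace A W} = ⊤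

/-- `W 0, …, W d` is an ordering of the eigenspaces of `A` (each listed exactly once) which is
standard with respect to `B`: one has `B (W i) ⊆ W (i-1) + W i + W (i+1)` for `0 ≤ i ≤ d`, where
`W (-1) = 0 = W (d+1)`. -/
structure IsStandardOrdering (A B : End K V) {d : ℕ} (W : Fin (d + 1) → Submodule K V) :
    Prop where
  injective : Function.Injective W
  range_eq : Set.range W = {U : Submodule K V | IsEigenspace A U}
  tridiagonal : ∀ i, (W i).map B ≤
    ⨆ j : Fin (d + 1), ⨆ _ : (j : ℕ) ≤ (i : ℕ) + 1 ∧ (i : ℕ) ≤ (j : ℕ) + 1, W j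

/-- `A, B` (with `B` in the role of `A^*`) is a tridiagonal pair on `V`. -/
structure IsTridiagonalPair (A B : End K V) : Prop where
  diagonalizable_left : IsDiagonalizable A
  diagonalizable_right : IsDiagonalizable B
  exists_ordering_left : ∃ (d : ℕ) (W : Fin (d + 1) → Submodule K V), IsStandardOrdering A B W
  exists_ordering_right : ∃ (δ : ℕ) (W : Fin (δ + 1) → Submodule K V), IsStandardOrdering B A W
  irreducible : ∀ W : Submodule K V, W.map A ≤ W → W.map B ≤ W → W = ⊥ ∨ W = ⊤

/-- `ρ 0, …, ρ d` is the shape of the tridiagonal pair `A, B`: for standard orderings `W i` and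
`W' i` of the eigenspaces of `A` and `B`, `ρ i` is the common dimension of `W i` and `W' i`. -/
def IsShape (A B : End K V) {d : ℕ} (ρ : Fin (d + 1) → ℕ) : Prop :=
  ∃ W W' : Fin (d + 1) → Submodule K V, IsStandardOrdering A B W ∧ IsStandardOrdering B A W' ∧
    ∀ i, finrank K (W i) = ρ i ∧ finrank K (W' i) = ρ i

/-- The tridiagonal pair `A, B` is sharp: its shape satisfies `ρ 0 = 1`. -/
def IsSharp (A B : End K V) : Prop :=
  ∃ (d : ℕ) (ρ : Fin (d + 1) → ℕ), IsShape A B ρ ∧ ρ 0 = 1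

/-- Isomorphism of the pairs `A, B` on `V` and `A', B'` on `V'`. -/
def PairIsomorphic (A B : End K V) (A' B' : End K V') : Prop :=
  ∃ γ : V ≃ₗ[K] V', (∀ v, γ (A v) = A' (γ v)) ∧ (∀ v, γ (B v) = B' (γ v))

/-- `E 0, …, E d` is a standard ordering of the primitive idempotents of `A` (with respect to
`B`): for a standard ordering `W 0, …, W d` of the eigenspaces of `A`, the map `E i` is the
identity on `W i` and zero on `W j` for `j ≠ i`. -/
def IsStandardIdempotents (A B : End K V) {d : ℕ} (E : Fin (d + 1) → End K V) : Prop :=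
  ∃ W : Fin (d + 1) → Submodule K V, IsStandardOrdering A B W ∧
    (∀ i, ∀ v ∈ W i, E i v = v) ∧ (∀ i j, j ≠ i → ∀ v ∈ W j, E i v = 0)

end Pairs

/-- A tridiagonal system `(A; {E i}; A^*; {E^* i})` of diameter `d` on `V`. -/
structure TridiagonalSystem (K : Type*) [Field K] (V : Type*) [AddCommGroup V] [Module K V]
    (d : ℕ) where
  A : End K V
  E : Fin (d + 1) → End K V
  As : End K V
  Es : Fin (d + 1) → End K V
  isTridiagonalPair : IsTridiagonalPair A As
  standard : IsStandardIdempotents A As E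
  standard_star : IsStandardIdempotents As A Es

/-- A sequence of scalars `({θ i}; {θ^* i}; {ζ i})`, each indexed by `0 ≤ i ≤ d`. -/
structure ParameterArray (K : Type*) (d : ℕ) where
  θ : Fin (d + 1) → K
  θs : Fin (d + 1) → K
  ζ : Fin (d + 1) → K

namespace TridiagonalSystem

variable {K : Type*} [Field K] {V : Type*} [AddCommGroup V] [Module K V] {d : ℕ}
variable {V' : Type*} [AddCommGroup V'] [Module K V'] {d' : ℕ}

/-- Isomorphism of tridiagonal systems (in particular the diameters agree). -/
def Isomorphic (Φ : TridiagonalSystem K V d) (Φ' : TridiagonalSystem K V' d') : Prop :=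
  d = d' ∧ ∃ γ : V ≃ₗ[K] V',
    (∀ v, γ (Φ.A v) = Φ'.A (γ v)) ∧ (∀ v, γ (Φ.As v) = Φ'.As (γ v)) ∧
    ∀ (i : Fin (d + 1)) (j : Fin (d' + 1)), (i : ℕ) = (j : ℕ) →
      (∀ v, γ (Φ.E i v) = Φ'.E j (γ v)) ∧ (∀ v, γ (Φ.Es i v) = Φ'.Es j (γ v))

/-- The `i`-th component of the split decomposition:
`U i = (E^*_0 V + ⋯ + E^*_i V) ∩ (E_i V + ⋯ + E_d V)`. -/
def splitSpace (Φ : TridiagonalSystem K V d) (i : Fin (d + 1)) : Submodule K V :=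
  (⨆ j : Fin (d + 1), ⨆ _ : j ≤ i, LinearMap.range (Φ.Es j)) ⊓
    (⨆ j : Fin (d + 1), ⨆ _ : i ≤ j, LinearMap.range (Φ.E j))

open Polynomial in
/-- The map `(A^* - θ^*_1) ⋯ (A^* - θ^*_i) (A - θ_{i-1}) ⋯ (A - θ_0)`. Each of the two groups of
factors is a polynomial in `A^*`, respectively `A`, so the order within a group is immaterial. -/
noncomputable def upDown (Φ : TridiagonalSystem K V d) (θ θs : Fin (d + 1) → K)
    (i : Fin (d + 1)) : End K V :=
  aeval Φ.As (∏ j ∈ Finset.Ioc 0 i, (X - C (θs j))) *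
    aeval Φ.A (∏ j ∈ Finset.Iio i, (X - C (θ j)))

/-- `p` is the parameter array of `Φ`. It is defined only when `Φ` is sharp; `θ i` and `θ^* i` are
the eigenvalues of `A` and `A^*` associated with `E i V` and `E^* i V`, and `ζ i` is the eigenvalue
of `upDown` on the (one-dimensional) space `U 0`. -/
structure IsParameterArray (Φ : TridiagonalSystem K V d) (p : ParameterArray K d) : Prop where
  sharp : IsSharp Φ.A Φ.As
  eigenvalue : ∀ i, LinearMap.range (Φ.E i) = Φ.A.eigenspace (p.θ i)
  eigenvalue_star : ∀ i, LinearMap.range (Φ.Es i) = Φ.As.eigenspace (p.θs i)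
  split : ∀ i, ∀ u ∈ Φ.splitSpace 0, Φ.upDown p.θ p.θs i u = p.ζ i • u

/-- `Φ` and `Φ'` have the same parameter array (in particular the diameters agree). -/
def SameParameterArray (Φ : TridiagonalSystem K V d) (Φ' : TridiagonalSystem K V' d') : Prop :=
  ∃ (h : d = d') (p : ParameterArray K d), Φ.IsParameterArray p ∧ Φ'.IsParameterArray (h ▸ p)

end TridiagonalSystem

section PairParameterArrays

variable {K : Type*} [Field K] {V : Type*} [AddCommGroup V] [Module K V]

/-- `p` is a parameter array of the pair `A, B`: it is the parameter array of an associated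
tridiagonal system. -/
def IsPairParameterArray (A B : End K V) {d : ℕ} (p : ParameterArray K d) : Prop :=
  ∃ Φ : TridiagonalSystem K V d, Φ.A = A ∧ Φ.As = B ∧ Φ.IsParameterArray p

/-- The pairs `A, B` and `A', B'` have a parameter array in common. -/
def HaveCommonParameterArray {V' : Type*} [AddCommGroup V'] [Module K V']
    (A B : End K V) (A' B' : End K V') : Prop :=
  ∃ (d : ℕ) (p : ParameterArray K d), IsPairParameterArray A B p ∧ IsPairParameterArray A' B' p

end PairParameterArrays

end Tridiagonal

/-! Write e for the idempotent E*_0 and T for the algebra generated by A and A*. Everything rests on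
two facts about the corner eTe: it is generated by the elements e f(A) e with f a polynomial
(`corner_word_mem`), and these elements commute (`idem_zero_mul_symmetric`). Both come from one
elimination. Since E_i g(A*) E_j = 0 when |i - j| > deg g, a matrix built from the products E_i
g(A*) E_j is banded, and a banded matrix with enough vanishing row and column moments is zero
(`band_mem_of_moments_mem`).

On E*_0 V the operator defining ζ_i is a nonzero multiple of e (A - θ_0)⋯(A - θ_{i-1})
(`aeval_aeval_eq_smul_idem`), so by Newton interpolation the parameter array fixes the scalar by
which each e f(A) e acts there. For two pairs with the same array, apply the generation statement
inside End V × End V': the corner then acts on E*_0 V and on E*_0 V' by one common scalar. Hence the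
submodule of V × V' generated by (v, v'), with v and v' nonzero in these two spaces, contains
neither (v, 0) nor (0, v'), and irreducibility makes it the graph of an isomorphism
(`pairIsomorphic_of_corner`). The converse is transport of structure; dim E*_0 V = 1 is what makes
the scalars ζ_i exist.

Over an algebraically closed field, eTe is commutative and carries any nonzero vector of E*_0 V to
every other one, so dim E*_0 V = 1 (`finrank_eigenspace_zero_of_isAlgClosed`). Equality of the two
diameters and of the dimensions of V_i and V*_i comes from comparing opposite flags
(`below_inf_above_eq_bot`). -/

namespace Tridiagonal

open Polynomial

/-! ### Banded matrices with vanishing moments. -/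

section Interpolation

variable {K : Type*} [Field K] {N : Type*} [AddCommGroup N] [Module K N] {d : ℕ}

/-- A family lying in `S` off a set of at most `r` indices, all of whose moments of degree `< r`
lie in `S`, lies in `S`. -/
theorem mem_of_moments_mem {ι : Type*} [Fintype ι] [DecidableEq ι] {θ : ι → K}
    (hθ : Function.Injective θ)
    (S : Submodule K N) (x : ι → N) (J : Finset ι) {r : ℕ} (hJ : J.card ≤ r)
    (hx : ∀ i, i ∉ J → x i ∈ S)
    (hf : ∀ f : K[X], f.degree < r → ∑ i, f.eval (θ i) • x i ∈ S) (i : ι) : x i ∈ S := by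
  by_cases hi : i ∈ J
  -- The Lagrange polynomial of `i` over `J` has degree `J.card - 1` and isolates `x i` among the
  -- indices of `J`; the other terms of its moment are already in `S`.
  · have hdeg : (Lagrange.basis J θ i).degree < r := by
      rw [Lagrange.degree_basis hθ.injOn hi]
      have : 0 < J.card := Finset.card_pos.2 ⟨i, hi⟩
      exact_mod_cast (by omega : J.card - 1 < r)
    have h := hf _ hdeg
    rw [← Finset.add_sum_erase _ _ (Finset.mem_univ i),
      Lagrange.eval_basis_self hθ.injOn hi, one_smul] at h
    refine (S.add_mem_iff_left (S.sum_mem fun j hj => ?_)).1 h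
    by_cases hjJ : j ∈ J
    · rw [Lagrange.eval_basis_of_ne (Finset.ne_of_mem_erase hj).symm hjJ, zero_smul]
      exact S.zero_mem
    · exact S.smul_mem _ (hx j hjJ)
  · exact hx i hi

theorem card_filter_le_lt (a b : ℕ) :
    (Finset.univ.filter fun i : Fin (d + 1) => a ≤ (i : ℕ) ∧ (i : ℕ) < b).card ≤ b - a := by
  rw [← Nat.card_Ico, ← Finset.card_map Fin.valEmbedding]
  refine Finset.card_le_card fun i hi => ?_
  simp only [Finset.mem_map, Finset.mem_filter, Finset.mem_univ, true_and] at hi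
  obtain ⟨j, hj, rfl⟩ := hi
  exact Finset.mem_Ico.2 hj

variable {θ : Fin (d + 1) → K} (hθ : Function.Injective θ) (S : Submodule K N)
  (β : Fin (d + 1) → Fin (d + 1) → N) (m : ℕ)

include hθ

/-- A matrix which is banded of width `m` modulo `S`, with vanishing column moments of degree
`≤ m` and row moments of degree `< m`, vanishes modulo `S`. -/
theorem band_mem_of_moments_mem
    (hband : ∀ i j : Fin (d + 1), (i : ℕ) + m < j ∨ (j : ℕ) + m < i → β i j ∈ S)
    (hcol : ∀ f : K[X], f.degree < (m + 1 : ℕ) → ∀ j, ∑ i, f.eval (θ i) • β i j ∈ S)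
    (hrow : ∀ f : K[X], f.degree < m → ∀ i, ∑ j, f.eval (θ j) • β i j ∈ S)
    (i j : Fin (d + 1)) : β i j ∈ S := by
  suffices H : ∀ k : ℕ, ∀ k' : Fin (d + 1), (k' : ℕ) = k →
      (∀ i, β i k' ∈ S) ∧ (∀ j, β k' j ∈ S) from (H _ j rfl).1 i
  intro k
  induction k using Nat.strong_induction_on with
  | _ k ih =>
    intro k' hk
    -- With rows and columns before `k` settled, the band leaves rows `k, …, k + m` of column `k`:
    -- `m + 1` unknowns against `m + 1` moments.
    have hc : ∀ i, β i k' ∈ S := by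
      refine mem_of_moments_mem hθ S (fun i => β i k') _ (r := m + 1)
        ((card_filter_le_lt k (k + m + 1)).trans (by omega)) (fun i hi => ?_) fun f hf => hcol f hf k'
      simp only [Finset.mem_filter, Finset.mem_univ, true_and, not_and_or, not_le, not_lt] at hi
      rcases hi with hi | hi
      · exact (ih i hi i rfl).2 k'
      · exact hband i k' (Or.inr (by omega))
    -- The column just treated settles the diagonal entry, so row `k` has only `m` unknowns. This is
    -- why one fewer row moment suffices.
    refine ⟨hc, mem_of_moments_mem hθ S (fun j => β k' j) _ (r := m)
      ((card_filter_le_lt (k + 1) (k + m + 1)).trans (by omega)) (fun j hj => ?_)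
      fun f hf => hrow f hf k'⟩
    simp only [Finset.mem_filter, Finset.mem_univ, true_and, not_and_or, not_le, not_lt] at hj
    rcases hj with hj | hj
    · rcases Nat.lt_succ_iff_lt_or_eq.1 hj with hj | hj
      · exact (ih j hj j rfl).1 k'
      · have : j = k' := Fin.ext (by omega)
        exact this ▸ hc k'
    · exact hband k' j (Or.inl (by omega))

/-- The variant of `band_mem_of_moments_mem` for matrices with zero diagonal. -/
theorem band_mem_of_moments_mem_of_diag
    (hdiag : ∀ i, β i i ∈ S)
    (hband : ∀ i j : Fin (d + 1), (i : ℕ) + m < j ∨ (j : ℕ) + m < i → β i j ∈ S)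
    (hcol : ∀ f : K[X], f.degree < m → ∀ j, ∑ i, f.eval (θ i) • β i j ∈ S)
    (hrow : ∀ f : K[X], f.degree < m → ∀ i, ∑ j, f.eval (θ j) • β i j ∈ S)
    (i j : Fin (d + 1)) : β i j ∈ S := by
  suffices H : ∀ k : ℕ, ∀ k' : Fin (d + 1), (k' : ℕ) = k →
      (∀ i, β i k' ∈ S) ∧ (∀ j, β k' j ∈ S) from (H _ j rfl).1 i
  intro k
  induction k using Nat.strong_induction_on with
  | _ k ih =>
    intro k' hk
    constructor
    -- Here the diagonal entry is known beforehand, so `m` moments suffice for the column as well.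
    · refine mem_of_moments_mem hθ S (fun i => β i k') _ (r := m)
        ((card_filter_le_lt (k + 1) (k + m + 1)).trans (by omega)) (fun i hi => ?_)
        fun f hf => hcol f hf k'
      simp only [Finset.mem_filter, Finset.mem_univ, true_and, not_and_or, not_le, not_lt] at hi
      rcases hi with hi | hi
      · rcases Nat.lt_succ_iff_lt_or_eq.1 hi with hi | hi
        · exact (ih i hi i rfl).2 k'
        · have : i = k' := Fin.ext (by omega)
          exact this ▸ hdiag i
      · exact hband i k' (Or.inr (by omega))
    · refine mem_of_moments_mem hθ S (fun j => β k' j) _ (r := m)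
        ((card_filter_le_lt (k + 1) (k + m + 1)).trans (by omega)) (fun j hj => ?_)
        fun f hf => hrow f hf k'
      simp only [Finset.mem_filter, Finset.mem_univ, true_and, not_and_or, not_le, not_lt] at hj
      rcases hj with hj | hj
      · rcases Nat.lt_succ_iff_lt_or_eq.1 hj with hj | hj
        · exact (ih j hj j rfl).1 k'
        · have : j = k' := Fin.ext (by omega)
          exact this ▸ hdiag j
      · exact hband k' j (Or.inl (by omega))

end Interpolation

/-! ### Lagrange idempotents, the tridiagonal relations, and commutation of the elements e f(a) e.
-/

section Algebra

variable {K : Type*} [Field K] {R : Type*} [Ring R] [Algebra K R] {d : ℕ}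

/-- The `i`-th Lagrange idempotent of `a` with respect to the nodes `θ`. -/
noncomputable def idem (a : R) (θ : Fin (d + 1) → K) (i : Fin (d + 1)) : R :=
  aeval a (Lagrange.basis Finset.univ θ i)

/-- `a` is annihilated by the split polynomial with simple roots `θ`, and `b` acts tridiagonally
on its eigenspaces. -/
structure IsTridiagonalOn (a b : R) (θ : Fin (d + 1) → K) : Prop where
  injective : Function.Injective θ
  nodal : aeval a (Lagrange.nodal Finset.univ θ) = 0
  tri : ∀ i j : Fin (d + 1), (i : ℕ) + 1 < j ∨ (j : ℕ) + 1 < i →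
    idem a θ i * b * idem a θ j = 0

/-- Each of `a` and `b` acts tridiagonally on the eigenspaces of the other. -/
structure IsTridiagonalData (a b : R) (θ θs : Fin (d + 1) → K) : Prop where
  left : IsTridiagonalOn a b θ
  right : IsTridiagonalOn b a θs

namespace IsTridiagonalOn

variable {a b : R} {θ : Fin (d + 1) → K}

theorem aeval_eq_of_eval_eq (h : IsTridiagonalOn a b θ) {f g : K[X]}
    (hfg : ∀ i, f.eval (θ i) = g.eval (θ i)) : aeval a f = aeval a g := by
  have hdvd : Lagrange.nodal Finset.univ θ ∣ f - g := by
    rw [Lagrange.nodal_eq]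
    refine Finset.prod_dvd_of_coprime (fun i _ j _ hij =>
      pairwise_coprime_X_sub_C h.injective hij) fun i _ => ?_
    rw [dvd_iff_isRoot, IsRoot.def, eval_sub, hfg, sub_self]
  obtain ⟨q, hq⟩ := hdvd
  rw [← sub_eq_zero, ← map_sub, hq, map_mul, h.nodal, zero_mul]

theorem aeval_eq_sum (h : IsTridiagonalOn a b θ) (f : K[X]) :
    aeval a f = ∑ i, f.eval (θ i) • idem a θ i := by
  have : aeval a f = aeval a (∑ i, f.eval (θ i) • Lagrange.basis Finset.univ θ i) := by
    refine h.aeval_eq_of_eval_eq fun i => ?_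
    rw [eval_finsetSum, Finset.sum_eq_single i]
    · simp [Lagrange.eval_basis_self h.injective.injOn (Finset.mem_univ i)]
    · intro j _ hj
      simp [Lagrange.eval_basis_of_ne hj (Finset.mem_univ i)]
    · simp
  rw [this, map_sum]
  simp [idem]

theorem sum_idem (h : IsTridiagonalOn a b θ) : ∑ i, idem a θ i = 1 := by
  simpa using (h.aeval_eq_sum 1).symm

theorem aeval_mul_idem (h : IsTridiagonalOn a b θ) (f : K[X]) (i : Fin (d + 1)) :
    aeval a f * idem a θ i = f.eval (θ i) • idem a θ i := by
  rw [idem, ← map_mul, ← map_smul]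
  refine h.aeval_eq_of_eval_eq fun j => ?_
  by_cases hij : i = j
  · simp [hij]
  · simp [Lagrange.eval_basis_of_ne hij (Finset.mem_univ j)]

theorem idem_mul_aeval (h : IsTridiagonalOn a b θ) (f : K[X]) (i : Fin (d + 1)) :
    idem a θ i * aeval a f = f.eval (θ i) • idem a θ i := by
  rw [← h.aeval_mul_idem, idem, ← map_mul, ← map_mul, mul_comm]

theorem idem_mul_self (h : IsTridiagonalOn a b θ) (i : Fin (d + 1)) :
    idem a θ i * idem a θ i = idem a θ i := by
  conv_lhs => enter [1]; rw [idem]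
  rw [h.aeval_mul_idem, Lagrange.eval_basis_self h.injective.injOn (Finset.mem_univ i), one_smul]

/-- Each factor `b` changes the eigenspace index by at most one; the induction inserts the
resolution of the identity before the last factor. -/
theorem idem_mul_pow_mul_idem (h : IsTridiagonalOn a b θ) (k : ℕ) :
    ∀ i j : Fin (d + 1), (i : ℕ) + k < j ∨ (j : ℕ) + k < i →
      idem a θ i * b ^ k * idem a θ j = 0 := by
  induction k with
  | zero =>
    intro i j hij
    have hne : j ≠ i := by rintro rfl; omega
    rw [pow_zero, mul_one, idem, h.aeval_mul_idem,
      Lagrange.eval_basis_of_ne hne.symm (Finset.mem_univ j), zero_smul]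
  | succ k ih =>
    intro i j hij
    have : idem a θ i * b ^ (k + 1) * idem a θ j
        = ∑ l, (idem a θ i * b ^ k * idem a θ l) * (b * idem a θ j) := by
      rw [← Finset.sum_mul, ← Finset.mul_sum, h.sum_idem, mul_one, pow_succ]
      simp only [mul_assoc]
    rw [this]
    refine Finset.sum_eq_zero fun l _ => ?_
    by_cases hl : (i : ℕ) + k < l ∨ (l : ℕ) + k < i
    · rw [ih i l hl, zero_mul]
    · rw [mul_assoc, ← mul_assoc (idem a θ l), h.tri l j (by omega), mul_zero]

theorem idem_mul_aeval_mul_idem (h : IsTridiagonalOn a b θ) {m : ℕ} {f : K[X]}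
    (hf : f.degree < (m + 1 : ℕ)) {i j : Fin (d + 1)}
    (hij : (i : ℕ) + m < j ∨ (j : ℕ) + m < i) :
    idem a θ i * aeval b f * idem a θ j = 0 := by
  have hf' : f.natDegree < m + 1 := by
    by_cases h0 : f = 0
    · simp [h0]
    · exact (natDegree_lt_iff_degree_lt h0).2 hf
  rw [aeval_eq_sum_range' hf', Finset.mul_sum, Finset.sum_mul]
  refine Finset.sum_eq_zero fun k hk => ?_
  have := Finset.mem_range.1 hk
  rw [mul_smul_comm, smul_mul_assoc, h.idem_mul_pow_mul_idem k i j (by omega), smul_zero]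

end IsTridiagonalOn

namespace IsTridiagonalData

variable {a b : R} {θ θs : Fin (d + 1) → K}

theorem symm (h : IsTridiagonalData a b θ θs) : IsTridiagonalData b a θs θ :=
  ⟨h.right, h.left⟩

/-- Next to `E^*_0 f(A)` with `deg f ≤ m`, a polynomial in `A^*` only matters through its values
at the first `m + 1` nodes. -/
theorem idem_zero_mul_mul_eq (h : IsTridiagonalData a b θ θs) {m : ℕ} {f g g' : K[X]}
    (hf : f.degree < (m + 1 : ℕ))
    (hg : ∀ i : Fin (d + 1), (i : ℕ) ≤ m → g.eval (θs i) = g'.eval (θs i)) :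
    idem b θs 0 * aeval a f * aeval b g = idem b θs 0 * aeval a f * aeval b g' := by
  rw [h.right.aeval_eq_sum g, h.right.aeval_eq_sum g', Finset.mul_sum, Finset.mul_sum]
  refine Finset.sum_congr rfl fun i _ => ?_
  by_cases hi : (i : ℕ) ≤ m
  · rw [hg i hi]
  · rw [mul_smul_comm, mul_smul_comm, h.right.idem_mul_aeval_mul_idem hf
      (Or.inl (by simpa using hi)), smul_zero, smul_zero]

theorem mul_mul_idem_zero_eq (h : IsTridiagonalData a b θ θs) {m : ℕ} {f g g' : K[X]}
    (hf : f.degree < (m + 1 : ℕ))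
    (hg : ∀ i : Fin (d + 1), (i : ℕ) ≤ m → g.eval (θs i) = g'.eval (θs i)) :
    aeval b g * aeval a f * idem b θs 0 = aeval b g' * aeval a f * idem b θs 0 := by
  rw [h.right.aeval_eq_sum g, h.right.aeval_eq_sum g', Finset.sum_mul, Finset.sum_mul,
    Finset.sum_mul, Finset.sum_mul]
  refine Finset.sum_congr rfl fun i _ => ?_
  by_cases hi : (i : ℕ) ≤ m
  · rw [hg i hi]
  · rw [smul_mul_assoc, smul_mul_assoc, smul_mul_assoc, smul_mul_assoc,
      h.right.idem_mul_aeval_mul_idem hf (Or.inr (by simpa using hi)), smul_zero, smul_zero]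

/-- A polynomial with the same values as `g` at the nodes `θs i`, `l ≤ i < n`. -/
theorem exists_interpolant (hinj : Function.Injective θs) (g : K[X]) (l n : ℕ) :
    ∃ q : K[X], q.degree < (n - l : ℕ) ∧
      ∀ i : Fin (d + 1), l ≤ (i : ℕ) → (i : ℕ) < n → q.eval (θs i) = g.eval (θs i) := by
  refine ⟨Lagrange.interpolate (Finset.univ.filter fun i : Fin (d + 1) => l ≤ (i : ℕ) ∧ (i : ℕ) < n)
    θs fun i => g.eval (θs i), ?_, fun i h1 h2 => ?_⟩
  · exact (Lagrange.degree_interpolate_lt _ hinj.injOn).trans_le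
      (by exact_mod_cast card_filter_le_lt l n)
  · exact Lagrange.eval_interpolate_at_node (fun i => g.eval (θs i)) hinj.injOn (by simp [h1, h2])

/-- Induction on the degree of the middle block. The antisymmetrization of e E_i g(b) E_j e has zero
diagonal and bandwidth `s`, so it is enough to kill its moments of degree `< s`; for those, `g` can
be replaced by a polynomial of smaller degree. -/
theorem idem_zero_mul_symmetric (h : IsTridiagonalData a b θ θs) (s : ℕ) :
    ∀ g : K[X], g.degree < s → ∀ f f' : K[X],
      idem b θs 0 * aeval a f * aeval b g * aeval a f' * idem b θs 0 =
        idem b θs 0 * aeval a f' * aeval b g * aeval a f * idem b θs 0 := by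
  induction s with
  | zero =>
    intro g hg f f'
    have : g = 0 := by simpa using hg
    simp [this]
  | succ s ih =>
    intro g hg f f'
    set e := idem b θs 0
    have key : ∀ u v : K[X], u.degree < s →
        e * aeval a u * aeval b g * aeval a v * e = e * aeval a v * aeval b g * aeval a u * e := by
      intro u v hu
      rcases Nat.eq_zero_or_pos s with rfl | hs
      · have : u = 0 := by simpa using hu
        simp [this]
      -- As `u` has degree at most `s - 1`, next to e u(a) only the first `s` nodes of `b` are felt.
      -- So `g` may be traded for its interpolant `q` of degree `< s`, the inductive hypothesis
      -- applied to `q`, and `g` restored on the other side.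
      obtain ⟨q, hq, hqe⟩ := exists_interpolant h.right.injective g 0 s
      have hu' : u.degree < ((s - 1) + 1 : ℕ) := by rwa [Nat.sub_add_cancel hs]
      rw [h.idem_zero_mul_mul_eq (g' := q) hu' fun i hi => (hqe i (Nat.zero_le _) (by omega)).symm,
        ih q (by simpa using hq)]
      have := h.mul_mul_idem_zero_eq (g' := q) hu'
        (g := g) fun i hi => (hqe i (Nat.zero_le _) (by omega)).symm
      simp only [mul_assoc] at this ⊢
      rw [this]
    have hβ := band_mem_of_moments_mem_of_diag h.left.injective (⊥ : Submodule K R)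
      (fun i j => e * idem a θ i * aeval b g * idem a θ j * e -
        e * idem a θ j * aeval b g * idem a θ i * e) s (fun i => by simp)
      (fun i j hij => by
        have h1 := h.left.idem_mul_aeval_mul_idem hg hij
        have h2 := h.left.idem_mul_aeval_mul_idem hg hij.symm
        simp only [mul_assoc] at h1 h2
        rw [Submodule.mem_bot]
        simp only [mul_assoc]
        rw [← mul_assoc (aeval b g), ← mul_assoc (idem a θ i), h1,
          ← mul_assoc (aeval b g), ← mul_assoc (idem a θ j), h2]
        simp)
      (fun u hu j => by
        rw [Submodule.mem_bot]
        have := key u (Lagrange.basis Finset.univ θ j) hu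
        rw [← sub_eq_zero, h.left.aeval_eq_sum u] at this
        simpa [Finset.mul_sum, Finset.sum_mul, smul_sub, idem] using this)
      (fun u hu i => by
        rw [Submodule.mem_bot]
        have := (key u (Lagrange.basis Finset.univ θ i) hu).symm
        rw [← sub_eq_zero, h.left.aeval_eq_sum u] at this
        simpa [Finset.mul_sum, Finset.sum_mul, smul_sub, idem] using this)
    simp only [Submodule.mem_bot, sub_eq_zero] at hβ
    rw [h.left.aeval_eq_sum f, h.left.aeval_eq_sum f']
    simp only [Finset.mul_sum, Finset.sum_mul, mul_smul_comm, smul_mul_assoc, Finset.smul_sum]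
    rw [Finset.sum_comm]
    refine Finset.sum_congr rfl fun i _ => Finset.sum_congr rfl fun j _ => ?_
    rw [hβ, smul_comm]

/-- The elements of `E^*_0 D E^*_0` commute. -/
theorem commute_corner (h : IsTridiagonalData a b θ θs) (f f' : K[X]) :
    Commute (idem b θs 0 * aeval a f * idem b θs 0) (idem b θs 0 * aeval a f' * idem b θs 0) := by
  -- The idempotent e is itself a polynomial of degree `d` in `b`, so it can serve as the middle
  -- block.
  have hdeg : (Lagrange.basis Finset.univ θs (0 : Fin (d + 1))).degree < (d + 1 : ℕ) := by
    rw [Lagrange.degree_basis h.right.injective.injOn (Finset.mem_univ _), Finset.card_univ,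
      Fintype.card_fin]
    exact_mod_cast Nat.lt_succ_self d
  have := h.idem_zero_mul_symmetric (d + 1) _ hdeg f f'
  have hid := h.right.idem_mul_self 0
  simp only [commute_iff_eq, mul_assoc] at this ⊢
  rw [← mul_assoc (idem b θs 0) (idem b θs 0), hid,
    ← mul_assoc (idem b θs 0) (idem b θs 0), hid]
  exact this

end IsTridiagonalData

end Algebra

/-! ### Generation of the corner eTe by the elements e f(a) e. -/

section Generation

variable {K : Type*} [Field K] {R : Type*} [Ring R] [Algebra K R] {d : ℕ}

/-- The alternating product `f₁(a) f₂(b) f₃(a) ⋯` (starting with `b` if the flag is `false`). -/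
noncomputable def word (a b : R) : Bool → List K[X] → R
  | _, [] => 1
  | s, f :: l => aeval (cond s a b) f * word a b (!s) l

/-- The flag `t` records which generator comes next after `l`; it does not depend on `l'`. -/
theorem exists_word_append (a b : R) (s : Bool) (l : List K[X]) :
    ∃ t, ∀ l', word a b s (l ++ l') = word a b s l * word a b t l' := by
  induction l generalizing s with
  | nil => exact ⟨s, fun l' => by simp [word]⟩
  | cons f l ih =>
    obtain ⟨t, ht⟩ := ih (!s)
    exact ⟨t, fun l' => by simp [word, ht, mul_assoc]⟩

namespace IsTridiagonalData

variable {a b : R} {θ θs : Fin (d + 1) → K}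

/-- An inner block `F(b)` of degree at most `m` allows one to reduce to the case where the block
on its left has degree at most `m` or the block on its right has degree less than `m`. -/
theorem mem_of_block (h : IsTridiagonalData a b θ θs) (S : Submodule K R) (p r : R) {m : ℕ}
    {F : K[X]} (hF : F.degree < (m + 1 : ℕ))
    (hcol : ∀ u v : K[X], u.degree < (m + 1 : ℕ) →
      p * (aeval a u * aeval b F * aeval a v) * r ∈ S)
    (hrow : ∀ u v : K[X], v.degree < m → p * (aeval a u * aeval b F * aeval a v) * r ∈ S)
    (u v : K[X]) : p * (aeval a u * aeval b F * aeval a v) * r ∈ S := by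
  have hβ := band_mem_of_moments_mem h.left.injective S
    (fun i j => p * (idem a θ i * aeval b F * idem a θ j) * r) m
    (fun i j hij => by
      rw [h.left.idem_mul_aeval_mul_idem hF hij]
      simp)
    (fun u hu j => by
      have := hcol u (Lagrange.basis Finset.univ θ j) hu
      rw [h.left.aeval_eq_sum u] at this
      simpa [Finset.mul_sum, Finset.sum_mul, idem] using this)
    (fun v hv i => by
      have := hrow (Lagrange.basis Finset.univ θ i) v hv
      rw [h.left.aeval_eq_sum v] at this
      simpa [Finset.mul_sum, Finset.sum_mul, idem] using this)
  rw [h.left.aeval_eq_sum u, h.left.aeval_eq_sum v]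
  simp only [Finset.mul_sum, Finset.sum_mul, mul_smul_comm, smul_mul_assoc]
  exact S.sum_mem fun i _ => S.smul_mem _ (S.sum_mem fun j _ => S.smul_mem _ (hβ _ _))

/-- Modulo polynomials of degree `< m`, a polynomial in `b` next to `E^*_0 f(a)` with
`deg f ≤ m` is a multiple of `E^*_0`. -/
theorem exists_reduction (h : IsTridiagonalData a b θ θs) (g : K[X]) (m : ℕ) :
    ∃ (q : K[X]) (c : K), q.degree < m ∧ ∀ f : K[X], f.degree < (m + 1 : ℕ) →
      (idem b θs 0 * aeval a f * aeval b g = idem b θs 0 * aeval a f * aeval b q +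
        c • (idem b θs 0 * aeval a f * idem b θs 0)) ∧
      (aeval b g * aeval a f * idem b θs 0 = aeval b q * aeval a f * idem b θs 0 +
        c • (idem b θs 0 * aeval a f * idem b θs 0)) := by
  -- Interpolating at nodes `1, …, m` only keeps the degree below `m`; the discrepancy at node `0`
  -- is corrected by a multiple of e.
  obtain ⟨q, hq, hqe⟩ := exists_interpolant h.right.injective g 1 (m + 1)
  set c := g.eval (θs 0) - q.eval (θs 0) with hc
  have hval : ∀ i : Fin (d + 1), (i : ℕ) ≤ m → g.eval (θs i) =
      (q + c • Lagrange.basis Finset.univ θs 0).eval (θs i) := by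
    intro i hi
    by_cases h0 : i = 0
    · subst h0
      simp [Lagrange.eval_basis_self h.right.injective.injOn (Finset.mem_univ _), hc]
    · have : 1 ≤ (i : ℕ) := Nat.one_le_iff_ne_zero.2 fun h' => h0 (Fin.ext h')
      simp [Lagrange.eval_basis_of_ne (Ne.symm h0) (Finset.mem_univ i),
        hqe i this (by omega)]
  refine ⟨q, c, by simpa using hq, fun f hf => ⟨?_, ?_⟩⟩
  · rw [h.idem_zero_mul_mul_eq hf hval, map_add, map_smul, mul_add, mul_smul_comm]
    rfl
  · rw [h.mul_mul_idem_zero_eq hf hval, map_add, map_smul, add_mul, add_mul, smul_mul_assoc,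
      smul_mul_assoc]
    rfl

/-- Nested induction: on the length of the word, then on a degree bound for one chosen block, then
on the position of that block. Degrees are pushed down until a block vanishes, and whenever an e
appears inside the word it splits it into shorter corner words. -/
theorem corner_word_mem (h : IsTridiagonalData a b θ θs) (S : Subalgebra K R)
    (hS : ∀ f : K[X], idem b θs 0 * aeval a f * idem b θs 0 ∈ S) (n : ℕ) :
    ∀ l : List K[X], l.length = n → idem b θs 0 * word a b true l * idem b θs 0 ∈ S := by
  induction n using Nat.strong_induction_on with
  | _ n ihn =>
  set e := idem b θs 0 with he
  have hee : e * e = e := h.right.idem_mul_self 0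
  have hshort : ∀ l : List K[X], l.length < n → e * word a b true l * e ∈ S :=
    fun l hl => ihn _ hl l rfl
  have hm : ∀ m : ℕ, ∀ (l₁ : List K[X]) (F : K[X]) (l₂ : List K[X]),
      l₁.length + 1 + l₂.length = n → F.degree < m →
      e * word a b true (l₁ ++ F :: l₂) * e ∈ S := by
    intro m
    induction m with
    | zero =>
      intro l₁ F l₂ _ hF
      have hF : F = 0 := by simpa using hF
      obtain ⟨t, ht⟩ := exists_word_append a b true l₁
      simp [ht, word, hF]
    | succ m ihm =>
      intro l₁
      induction hk : l₁.length generalizing l₁ with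
      | zero =>
        intro F l₂ hn hF
        obtain rfl := List.length_eq_zero_iff.1 hk
        cases l₂ with
        | nil => simpa [word] using hS F
        | cons g l₃ =>
          -- The low-degree block touches the left e, so its right neighbour `g` becomes a block of
          -- degree `< m` plus a multiple of e, which cuts the word.
          obtain ⟨q, c, hq, hqc⟩ := h.exists_reduction g m
          have h1 := ihm [F] q l₃ (by simp at hn ⊢; omega) hq
          have h2 := hshort l₃ (by simp at hn; omega)
          have h3 := S.smul_mem (S.mul_mem (hS F) h2) c
          have heq : e * word a b true ([] ++ F :: g :: l₃) * e =
              e * word a b true ([F] ++ q :: l₃) * e +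
                c • (e * aeval a F * e * (e * word a b true l₃ * e)) := by
            have := congrArg (fun x => x * (word a b true l₃ * e)) (hqc F hF).1
            simp only [add_mul, smul_mul_assoc] at this
            simp only [word, List.nil_append, List.cons_append, cond_true, Bool.not_true,
              cond_false, Bool.not_false]
            have h4 : e * aeval a F * e * (e * word a b true l₃ * e) =
                e * aeval a F * e * (word a b true l₃ * e) := by
              simp only [mul_assoc]
              rw [← mul_assoc e e, hee]
            rw [h4]
            simpa only [mul_assoc] using this
          rw [heq]
          exact S.add_mem h1 h3
      | succ k ihk =>
        intro F l₂ hn hF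
        obtain ⟨l₀, f, rfl⟩ : ∃ l₀ f, l₁ = l₀ ++ [f] := by
          rcases List.eq_nil_or_concat l₁ with rfl | ⟨l₀, f, rfl⟩
          · simp at hk
          · exact ⟨l₀, f, by simp⟩
        have hk₀ : l₀.length = k := by simpa using hk
        obtain ⟨t, ht⟩ := exists_word_append a b true l₀
        cases l₂ with
        | nil =>
          cases t with
          | true =>
            -- The last block is a polynomial in `b` beside e, hence is absorbed as a scalar.
            have h1 := hshort (l₀ ++ [f]) (by simp at hn ⊢; omega)
            have h2 := h.right.aeval_mul_idem F 0
            have heq : e * word a b true ((l₀ ++ [f]) ++ [F]) * e =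
                F.eval (θs 0) • (e * word a b true (l₀ ++ [f]) * e) := by
              rw [List.append_assoc, ht, ht]
              simp only [word, List.cons_append, List.nil_append, cond_true, Bool.not_true,
                cond_false, mul_one, mul_assoc]
              rw [h2]
              simp only [mul_smul_comm, he]
            rw [heq]
            exact S.smul_mem h1 _
          | false =>
            -- Mirror image of the reduction at the left end.
            obtain ⟨q, c, hq, hqc⟩ := h.exists_reduction f m
            have h1 := ihm l₀ q [F] (by simp at hn ⊢; omega) hq
            have h2 := hshort l₀ (by simp at hn; omega)
            have h3 := S.smul_mem (S.mul_mem h2 (hS F)) c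
            have heq : e * word a b true ((l₀ ++ [f]) ++ [F]) * e =
                e * word a b true (l₀ ++ q :: [F]) * e +
                  c • (e * word a b true l₀ * e * (e * aeval a F * e)) := by
              have := congrArg (fun x => e * word a b true l₀ * x) (hqc F hF).2
              simp only [mul_add, mul_smul_comm] at this
              rw [List.append_assoc, ht, ht]
              simp only [word, List.cons_append, List.nil_append, cond_true, Bool.not_false,
                cond_false, mul_one]
              have h4 : e * word a b true l₀ * e * (e * aeval a F * e) =
                  e * word a b true l₀ * (e * aeval a F * e) := by
                simp only [mul_assoc]
                rw [← mul_assoc e e, hee]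
              rw [h4]
              simpa only [mul_assoc] using this
            rw [heq]
            exact S.add_mem h1 h3
        | cons g l₃ =>
          have hw : ∀ u v : K[X], e * word a b true (l₀ ++ u :: F :: v :: l₃) * e =
              e * word a b true l₀ * (aeval (cond t a b) u * aeval (cond (!t) a b) F *
                aeval (cond t a b) v) * (word a b (!t) l₃ * e) := by
            intro u v
            simp only [ht, word, Bool.not_not, mul_assoc]
          -- An interior block: by elimination, either the left neighbour has degree at most `m` and
          -- sits one position earlier, or the right neighbour has degree `< m`. The two inner
          -- inductive hypotheses cover these.
          have hcol : ∀ u v : K[X], u.degree < (m + 1 : ℕ) →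
              e * word a b true (l₀ ++ u :: F :: v :: l₃) * e ∈ S := fun u v hu =>
            ihk l₀ hk₀ u (F :: v :: l₃) (by simp at hn ⊢; omega) hu
          have hrow : ∀ u v : K[X], v.degree < m →
              e * word a b true (l₀ ++ u :: F :: v :: l₃) * e ∈ S := fun u v hv => by
            simpa using ihm (l₀ ++ [u, F]) v l₃ (by simp at hn ⊢; omega) hv
          rw [List.append_assoc, List.singleton_append, hw]
          simp only [hw] at hcol hrow
          cases t with
          | true => exact h.mem_of_block (Subalgebra.toSubmodule S) _ _ hF hcol hrow f g
          | false => exact h.symm.mem_of_block (Subalgebra.toSubmodule S) _ _ hF hcol hrow f g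
  intro l hl
  cases l with
  | nil => simpa [word] using hS 1
  | cons F l =>
    exact hm (F.natDegree + 1) [] F l (by simp at hl ⊢; omega)
      (degree_le_natDegree.trans_lt (by exact_mod_cast Nat.lt_succ_self _))

/-- The corner `E^*_0 T E^*_0` is generated by `E^*_0 D E^*_0`. -/
theorem corner_mem (h : IsTridiagonalData a b θ θs) (S : Subalgebra K R)
    (hS : ∀ f : K[X], idem b θs 0 * aeval a f * idem b θs 0 ∈ S) {t : R}
    (ht : t ∈ Algebra.adjoin K {a, b}) : idem b θs 0 * t * idem b θs 0 ∈ S := by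
  have hspan : t ∈ Submodule.span K (Submonoid.closure {a, b} : Set R) := by
    rw [← Algebra.adjoin_eq_span]
    exact ht
  clear ht
  induction hspan using Submodule.span_induction with
  | mem x hx =>
    -- Blocks equal to `1` pad an arbitrary monomial into an alternating word.
    obtain ⟨l, rfl⟩ : ∃ l : List K[X], word a b true l = x := by
      induction hx using Submonoid.closure_induction_left with
      | one => exact ⟨[], rfl⟩
      | mul_left x hx y _ hy =>
        obtain ⟨l, rfl⟩ := hy
        rcases hx with rfl | rfl
        · exact ⟨X :: 1 :: l, by simp [word]⟩
        · exact ⟨1 :: X :: l, by simp [word]⟩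
    exact h.corner_word_mem S hS _ l rfl
  | zero => simp
  | add x y _ _ hx hy =>
    rw [mul_add, add_mul]
    exact S.add_mem hx hy
  | smul c x _ hx =>
    rw [mul_smul_comm, smul_mul_assoc]
    exact S.smul_mem hx c

end IsTridiagonalData

end Generation

/-! ### Opposite flags of the two operators. -/

section Flags

variable {K : Type*} [Field K] {V : Type*} [AddCommGroup V] [Module K V] {d δ : ℕ}

/-- The sum of the eigenspaces of `A` for `θ 0, …, θ (i - 1)`, as an intersection of kernels. -/
noncomputable def below (A : End K V) (θ : Fin (d + 1) → K) (i : ℕ) : Submodule K V :=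
  ⨅ k : Fin (d + 1), ⨅ _ : i ≤ (k : ℕ), LinearMap.ker (idem A θ k)

/-- The sum of the eigenspaces of `A` for `θ i, …, θ d`, as an intersection of kernels. -/
noncomputable def above (A : End K V) (θ : Fin (d + 1) → K) (i : ℕ) : Submodule K V :=
  ⨅ k : Fin (d + 1), ⨅ _ : (k : ℕ) < i, LinearMap.ker (idem A θ k)

theorem mem_below {A : End K V} {θ : Fin (d + 1) → K} {i : ℕ} {x : V} :
    x ∈ below A θ i ↔ ∀ k : Fin (d + 1), i ≤ (k : ℕ) → idem A θ k x = 0 := by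
  simp [below]

theorem mem_above {A : End K V} {θ : Fin (d + 1) → K} {i : ℕ} {x : V} :
    x ∈ above A θ i ↔ ∀ k : Fin (d + 1), (k : ℕ) < i → idem A θ k x = 0 := by
  simp [above]

namespace IsTridiagonalOn

variable {A B : End K V} {θ : Fin (d + 1) → K} {θs : Fin (δ + 1) → K}

theorem sum_idem_apply (h : IsTridiagonalOn A B θ) (x : V) : ∑ k, idem A θ k x = x := by
  have := congrArg (fun f : End K V => f x) h.sum_idem
  simpa using this

theorem idem_apply_idem (h : IsTridiagonalOn A B θ) (k l : Fin (d + 1)) (x : V) :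
    idem A θ k (idem A θ l x) = if k = l then idem A θ l x else 0 := by
  have := congrArg (fun f : End K V => f x)
    (h.aeval_mul_idem (Lagrange.basis Finset.univ θ k) l)
  split_ifs with hkl
  · subst hkl
    simpa [Lagrange.eval_basis_self h.injective.injOn (Finset.mem_univ _), idem] using this
  · simpa [Lagrange.eval_basis_of_ne hkl (Finset.mem_univ _), idem] using this

theorem idem_apply_apply (h : IsTridiagonalOn A B θ) (k : Fin (d + 1)) (x : V) :
    idem A θ k (A x) = θ k • idem A θ k x := by
  have := congrArg (fun f : End K V => f x) (h.idem_mul_aeval X k)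
  simpa using this

theorem apply_idem (h : IsTridiagonalOn A B θ) (k : Fin (d + 1)) (x : V) :
    A (idem A θ k x) = θ k • idem A θ k x := by
  have := congrArg (fun f : End K V => f x) (h.aeval_mul_idem X k)
  simpa using this

theorem idem_apply_other (h : IsTridiagonalOn A B θ) (k : Fin (d + 1)) (x : V)
    (hx : ∀ l : Fin (d + 1), (k : ℕ) ≤ l + 1 → (l : ℕ) ≤ k + 1 → idem A θ k (B (idem A θ l x)) = 0) :
    idem A θ k (B x) = 0 := by
  conv_lhs => rw [← h.sum_idem_apply x]
  rw [map_sum, map_sum]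
  refine Finset.sum_eq_zero fun l _ => ?_
  by_cases hl : (k : ℕ) ≤ l + 1 ∧ (l : ℕ) ≤ k + 1
  · exact hx l hl.1 hl.2
  · have := congrArg (fun f : End K V => f x) (h.tri k l (by omega))
    simpa using this

theorem range_idem (h : IsTridiagonalOn A B θ) (i : Fin (d + 1)) :
    LinearMap.range (idem A θ i) = A.eigenspace (θ i) := by
  ext x
  rw [End.mem_eigenspace_iff]
  constructor
  · rintro ⟨y, rfl⟩
    exact h.apply_idem i y
  · intro hx
    refine ⟨x, ?_⟩
    conv_rhs => rw [← h.sum_idem_apply x]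
    rw [Finset.sum_eq_single i]
    · intro j _ hj
      have h1 := h.idem_apply_apply j x
      rw [hx, map_smul, ← sub_eq_zero, ← sub_smul] at h1
      exact (smul_eq_zero.1 h1).resolve_left (sub_ne_zero.2 (h.injective.ne hj.symm))
    · simp

theorem below_zero (h : IsTridiagonalOn A B θ) : below A θ 0 = ⊥ := by
  refine (Submodule.eq_bot_iff _).2 fun x hx => ?_
  rw [← h.sum_idem_apply x]
  exact Finset.sum_eq_zero fun k _ => mem_below.1 hx k (Nat.zero_le _)

theorem above_eq_bot (h : IsTridiagonalOn A B θ) {i : ℕ} (hi : d < i) : above A θ i = ⊥ := by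
  refine (Submodule.eq_bot_iff _).2 fun x hx => ?_
  rw [← h.sum_idem_apply x]
  exact Finset.sum_eq_zero fun k _ => mem_above.1 hx k (by omega)

theorem below_eq_top (A : End K V) (θ : Fin (d + 1) → K) {i : ℕ} (hi : d < i) :
    below A θ i = ⊤ :=
  eq_top_iff.2 fun _ _ => mem_below.2 fun k hk => absurd hk (by omega)

theorem sub_mem_above (h : IsTridiagonalOn A B θ) {x : V} (i : Fin (d + 1))
    (hx : x ∈ above A θ i) : A x - θ i • x ∈ above A θ (i + 1) := by
  refine mem_above.2 fun k hk => ?_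
  rw [map_sub, map_smul, h.idem_apply_apply]
  rcases Nat.lt_succ_iff_lt_or_eq.1 hk with hk | hk
  · simp [mem_above.1 hx k hk]
  · rw [Fin.ext hk, sub_self]

theorem sub_mem_below (h : IsTridiagonalOn A B θ) {x : V} (i : Fin (d + 1))
    (hx : x ∈ below A θ (i + 1)) : A x - θ i • x ∈ below A θ i := by
  refine mem_below.2 fun k hk => ?_
  rw [map_sub, map_smul, h.idem_apply_apply]
  rcases Nat.lt_or_eq_of_le hk with hk | hk
  · simp [mem_below.1 hx k hk]
  · rw [Fin.ext hk, sub_self]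

theorem apply_mem_above (h : IsTridiagonalOn A B θ) {x : V} {i : ℕ}
    (hx : x ∈ above A θ (i + 1)) : B x ∈ above A θ i :=
  mem_above.2 fun k hk => h.idem_apply_other k x fun l _ hl => by
    rw [mem_above.1 hx l (by omega), map_zero, map_zero]

theorem apply_mem_below (h : IsTridiagonalOn A B θ) {x : V} {i : ℕ}
    (hx : x ∈ below A θ i) : B x ∈ below A θ (i + 1) :=
  mem_below.2 fun k hk => h.idem_apply_other k x fun l hl _ => by
    rw [mem_below.1 hx l (by omega), map_zero, map_zero]

theorem isCompl_below_above (h : IsTridiagonalOn A B θ) (i : ℕ) :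
    IsCompl (below A θ i) (above A θ i) := by
  constructor
  · refine Submodule.disjoint_def.2 fun x h1 h2 => ?_
    rw [← h.sum_idem_apply x]
    refine Finset.sum_eq_zero fun k _ => ?_
    rcases lt_or_ge (k : ℕ) i with hk | hk
    · exact mem_above.1 h2 k hk
    · exact mem_below.1 h1 k hk
  · refine codisjoint_iff.2 (eq_top_iff.2 fun x _ => ?_)
    rw [← h.sum_idem_apply x]
    refine Submodule.sum_mem _ fun k _ => ?_
    rcases lt_or_ge (k : ℕ) i with hk | hk
    · refine Submodule.mem_sup_left (mem_below.2 fun l hl => ?_)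
      rw [h.idem_apply_idem, if_neg (by rintro rfl; omega)]
    · refine Submodule.mem_sup_right (mem_above.2 fun l hl => ?_)
      rw [h.idem_apply_idem, if_neg (by rintro rfl; omega)]

theorem finrank_below_succ [FiniteDimensional K V] (h : IsTridiagonalOn A B θ)
    (i : Fin (d + 1)) :
    finrank K (below A θ (i + 1)) = finrank K (below A θ i) + finrank K (A.eigenspace (θ i)) := by
  rw [← h.range_idem]
  have hsup : below A θ i ⊔ LinearMap.range (idem A θ i) = below A θ (i + 1) := by
    apply le_antisymm
    · refine sup_le (fun x hx => mem_below.2 fun k hk => mem_below.1 hx k (by omega)) ?_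
      rintro _ ⟨y, rfl⟩
      refine mem_below.2 fun k hk => ?_
      rw [h.idem_apply_idem, if_neg (by rintro rfl; omega)]
    · intro x hx
      rw [← sub_add_cancel x (idem A θ i x)]
      refine Submodule.add_mem_sup (mem_below.2 fun k hk => ?_) ⟨x, rfl⟩
      rw [map_sub, h.idem_apply_idem]
      split_ifs with hki
      · rw [hki, sub_self]
      · rw [sub_zero]
        exact mem_below.1 hx k (Nat.lt_of_le_of_ne hk fun h' => hki (Fin.ext h'.symm))
  have hinf : below A θ i ⊓ LinearMap.range (idem A θ i) = ⊥ := by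
    refine (Submodule.eq_bot_iff _).2 ?_
    rintro x ⟨hx, y, rfl⟩
    have := mem_below.1 hx i le_rfl
    rwa [h.idem_apply_idem, if_pos rfl] at this
  have := Submodule.finrank_sup_add_finrank_inf_eq (below A θ i) (LinearMap.range (idem A θ i))
  rwa [hsup, hinf, finrank_bot, add_zero] at this

/-- The flags of `B` and of `A` are in opposition. -/
theorem below_inf_above_eq_bot (h : IsTridiagonalOn A B θ) (hs : IsTridiagonalOn B A θs)
    (hirr : ∀ W : Submodule K V, W.map A ≤ W → W.map B ≤ W → W = ⊥ ∨ W = ⊤)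
    (h0 : idem A θ 0 ≠ 0) (i : ℕ) : below B θs i ⊓ above A θ i = ⊥ := by
  -- On the `i`-th summand `A - θ i` leads to summand `i + 1`, and on summand `i + 1` the map `B -
  -- θs i` leads to summand `i`. Hence the sum is invariant under both maps.
  set W : Submodule K V := ⨆ i : ℕ, below B θs i ⊓ above A θ i with hW
  have hle : ∀ i, below B θs i ⊓ above A θ i ≤ W := fun i =>
    le_iSup (fun i : ℕ => below B θs i ⊓ above A θ i) i
  have hA : W.map A ≤ W := by
    rw [Submodule.map_le_iff_le_comap]
    refine iSup_le fun i x hx => ?_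
    rw [Submodule.mem_comap]
    by_cases hi : d < i
    · rw [h.above_eq_bot hi, inf_bot_eq, Submodule.mem_bot] at hx
      simp [hx]
    · have h1 := h.sub_mem_above ⟨i, by omega⟩ hx.2
      have h2 : A x - θ ⟨i, by omega⟩ • x ∈ below B θs (i + 1) :=
        Submodule.sub_mem _ (hs.apply_mem_below hx.1)
          (Submodule.smul_mem _ _ (mem_below.2 fun k hk => mem_below.1 hx.1 k (by omega)))
      rw [← sub_add_cancel (A x) (θ ⟨i, by omega⟩ • x)]
      exact W.add_mem (hle (i + 1) ⟨h2, h1⟩) (W.smul_mem _ (hle i hx))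
  have hB : W.map B ≤ W := by
    rw [Submodule.map_le_iff_le_comap]
    refine iSup_le fun i x hx => ?_
    rw [Submodule.mem_comap]
    cases i with
    | zero =>
      rw [hs.below_zero, bot_inf_eq, Submodule.mem_bot] at hx
      simp [hx]
    | succ i =>
      by_cases hi : δ < i
      · refine hle i ⟨?_, h.apply_mem_above hx.2⟩
        rw [below_eq_top B θs hi]
        trivial
      · have h1 := hs.sub_mem_below ⟨i, by omega⟩ hx.1
        have h2 : B x - θs ⟨i, by omega⟩ • x ∈ above A θ i :=
          Submodule.sub_mem _ (h.apply_mem_above hx.2)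
            (Submodule.smul_mem _ _ (mem_above.2 fun k hk => mem_above.1 hx.2 k (by omega)))
        rw [← sub_add_cancel (B x) (θs ⟨i, by omega⟩ • x)]
        exact W.add_mem (hle i ⟨h1, h2⟩) (W.smul_mem _ (hle (i + 1) hx))
  -- Summand `0` is zero and all others miss the `θ 0` eigenspace, which is nonzero.
  have hne : W ≠ ⊤ := by
    intro htop
    have hW1 : W ≤ above A θ 1 := by
      refine iSup_le fun i => ?_
      cases i with
      | zero => rw [hs.below_zero, bot_inf_eq]; exact bot_le
      | succ i => exact fun x hx => mem_above.2 fun k hk => mem_above.1 hx.2 k (by omega)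
    refine h0 (LinearMap.ext fun x => ?_)
    have hx : x ∈ above A θ 1 := hW1 (htop ▸ Submodule.mem_top)
    exact mem_above.1 hx 0 (by simp)
  exact eq_bot_iff.2 ((hle i).trans ((hirr W hA hB).resolve_right hne).le)

/-- One flag meets trivially a complement of the other, so its dimension cannot exceed that of the
other. -/
theorem finrank_below_le [FiniteDimensional K V]
    (h : IsTridiagonalOn A B θ) (hs : IsTridiagonalOn B A θs)
    (hirr : ∀ W : Submodule K V, W.map A ≤ W → W.map B ≤ W → W = ⊥ ∨ W = ⊤)
    (h0 : idem A θ 0 ≠ 0) (i : ℕ) : finrank K (below B θs i) ≤ finrank K (below A θ i) := by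
  have h1 := Submodule.finrank_sup_add_finrank_inf_eq (below B θs i) (above A θ i)
  rw [h.below_inf_above_eq_bot hs hirr h0, finrank_bot, add_zero] at h1
  have h2 := Submodule.finrank_add_eq_of_isCompl (h.isCompl_below_above i)
  have h3 := Submodule.finrank_le (below B θs i ⊔ above A θ i)
  omega

end IsTridiagonalOn

end Flags

/-! ### Standard orderings of eigenvalues, equality of diameters, and the shape. -/

section StandardEigenvalues

variable {K : Type*} [Field K] {V : Type*} [AddCommGroup V] [Module K V] {d δ : ℕ}

/-- `θ 0, …, θ d` are the eigenvalues of the diagonalizable map `A`, in an order that is standard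
with respect to `B`. -/
structure IsStandardEigenvalues (A B : End K V) (θ : Fin (d + 1) → K) : Prop where
  injective : Function.Injective θ
  ne_bot : ∀ i, A.eigenspace (θ i) ≠ ⊥
  iSup_eq_top : ⨆ i, A.eigenspace (θ i) = ⊤
  tridiagonal : ∀ i, (A.eigenspace (θ i)).map B ≤
    ⨆ j : Fin (d + 1), ⨆ _ : (j : ℕ) ≤ (i : ℕ) + 1 ∧ (i : ℕ) ≤ (j : ℕ) + 1, A.eigenspace (θ j)

theorem IsStandardOrdering.isStandardEigenvalues {A B : End K V}
    {W : Fin (d + 1) → Submodule K V} (h : IsStandardOrdering A B W) (hA : IsDiagonalizable A)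
    {θ : Fin (d + 1) → K} (hθ : ∀ i, W i = A.eigenspace (θ i)) : IsStandardEigenvalues A B θ where
  injective i j hij := h.injective (by rw [hθ, hθ, hij])
  ne_bot i := by
    have : W i ∈ {U : Submodule K V | IsEigenspace A U} := h.range_eq ▸ Set.mem_range_self i
    exact hθ i ▸ this.1
  iSup_eq_top := by
    rw [IsDiagonalizable, ← h.range_eq, sSup_range, iSup_congr hθ] at hA
    exact hA
  tridiagonal := by simpa only [hθ] using h.tridiagonal

theorem IsStandardOrdering.exists_eigenvalues {A B : End K V}
    {W : Fin (d + 1) → Submodule K V} (h : IsStandardOrdering A B W) :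
    ∃ θ : Fin (d + 1) → K, ∀ i, W i = A.eigenspace (θ i) := by
  have : ∀ i, ∃ μ, W i = A.eigenspace μ := fun i => by
    have : W i ∈ {U : Submodule K V | IsEigenspace A U} := h.range_eq ▸ Set.mem_range_self i
    exact this.2
  choose θ hθ using this
  exact ⟨θ, hθ⟩

theorem aeval_apply_of_mem_eigenspace {A : End K V} {μ : K} {x : V} (hx : x ∈ A.eigenspace μ)
    (f : K[X]) : aeval A f x = f.eval μ • x := by
  by_cases h0 : x = 0
  · simp [h0]
  · exact End.aeval_apply_of_hasEigenvector ⟨hx, h0⟩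

namespace IsStandardEigenvalues

variable {A B : End K V} {θ : Fin (d + 1) → K} {θs : Fin (δ + 1) → K}

theorem end_ext (h : IsStandardEigenvalues A B θ) {V' : Type*} [AddCommGroup V'] [Module K V']
    {f g : V →ₗ[K] V'} (hfg : ∀ i, ∀ x ∈ A.eigenspace (θ i), f x = g x) : f = g := by
  refine LinearMap.ext fun x => ?_
  have hx : x ∈ ⨆ i, A.eigenspace (θ i) := h.iSup_eq_top ▸ Submodule.mem_top
  refine Submodule.iSup_induction _ (motive := fun x => f x = g x) hx hfg (by simp) ?_
  intro x y hx hy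
  rw [map_add, map_add, hx, hy]

theorem idem_apply_of_mem (h : IsStandardEigenvalues A B θ) {i j : Fin (d + 1)} {x : V}
    (hx : x ∈ A.eigenspace (θ j)) : idem A θ i x = if i = j then x else 0 := by
  rw [idem, aeval_apply_of_mem_eigenspace hx]
  split_ifs with hij
  · rw [hij, Lagrange.eval_basis_self h.injective.injOn (Finset.mem_univ _), one_smul]
  · rw [Lagrange.eval_basis_of_ne hij (Finset.mem_univ _), zero_smul]

theorem isTridiagonalOn (h : IsStandardEigenvalues A B θ) : IsTridiagonalOn A B θ where
  injective := h.injective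
  nodal := h.end_ext fun i x hx => by
    rw [aeval_apply_of_mem_eigenspace hx, Lagrange.eval_nodal_at_node (Finset.mem_univ i)]
    simp
  tri i j hij := h.end_ext fun k x hx => by
    rw [End.mul_apply, End.mul_apply, h.idem_apply_of_mem hx]
    split_ifs with hjk
    · subst hjk
      have hle : (⨆ l : Fin (d + 1), ⨆ _ : (l : ℕ) ≤ (j : ℕ) + 1 ∧ (j : ℕ) ≤ (l : ℕ) + 1,
          A.eigenspace (θ l)) ≤ LinearMap.ker (idem A θ i) := by
        refine iSup_le fun l => iSup_le fun hl y hy => ?_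
        rw [LinearMap.mem_ker, h.idem_apply_of_mem hy, if_neg (by rintro rfl; omega)]
      simpa using hle (h.tridiagonal j (Submodule.mem_map_of_mem hx))
    · simp

theorem idem_ne_zero (h : IsStandardEigenvalues A B θ) (i : Fin (d + 1)) : idem A θ i ≠ 0 := by
  intro hz
  apply h.ne_bot i
  rw [← h.isTridiagonalOn.range_idem, hz, LinearMap.range_zero]

theorem exists_eq (h : IsStandardEigenvalues A B θ) {μ : K} (hμ : A.eigenspace μ ≠ ⊥) :
    ∃ i, μ = θ i := by
  obtain ⟨x, hx, hx0⟩ := Submodule.exists_mem_ne_zero_of_ne_bot hμ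
  have h1 := aeval_apply_of_mem_eigenspace hx (Lagrange.nodal Finset.univ θ)
  rw [h.isTridiagonalOn.nodal, LinearMap.zero_apply] at h1
  have h2 := (smul_eq_zero.1 h1.symm).resolve_right hx0
  rw [Lagrange.eval_nodal, Finset.prod_eq_zero_iff] at h2
  obtain ⟨i, -, hi⟩ := h2
  exact ⟨i, sub_eq_zero.1 hi⟩

theorem isStandardOrdering (h : IsStandardEigenvalues A B θ) :
    IsStandardOrdering A B fun i => A.eigenspace (θ i) where
  injective i j hij := by
    by_contra hne
    refine h.ne_bot i ((Submodule.eq_bot_iff _).2 fun x hx => ?_)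
    have hij' : A.eigenspace (θ i) = A.eigenspace (θ j) := hij
    have hx' : x ∈ A.eigenspace (θ j) := hij' ▸ hx
    have h1 := h.idem_apply_of_mem (i := i) hx
    rwa [h.idem_apply_of_mem hx', if_neg hne, if_pos rfl, eq_comm] at h1
  range_eq := by
    ext U
    constructor
    · rintro ⟨i, rfl⟩
      exact ⟨h.ne_bot i, θ i, rfl⟩
    · rintro ⟨hU, μ, rfl⟩
      obtain ⟨i, rfl⟩ := h.exists_eq hU
      exact ⟨i, rfl⟩
  tridiagonal := h.tridiagonal

theorem isStandardIdempotents (h : IsStandardEigenvalues A B θ) :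
    IsStandardIdempotents A B (idem A θ) :=
  ⟨_, h.isStandardOrdering, fun i v hv => by simp [h.idem_apply_of_mem hv],
    fun i j hij v hv => by simp [h.idem_apply_of_mem hv, hij.symm]⟩

variable [FiniteDimensional K V]

theorem finrank_below_eq (h : IsStandardEigenvalues A B θ) (hs : IsStandardEigenvalues B A θs)
    (hirr : ∀ W : Submodule K V, W.map A ≤ W → W.map B ≤ W → W = ⊥ ∨ W = ⊤) (i : ℕ) :
    finrank K (below A θ i) = finrank K (below B θs i) :=
  le_antisymm
    (hs.isTridiagonalOn.finrank_below_le h.isTridiagonalOn (fun W h1 h2 => hirr W h2 h1)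
      (hs.idem_ne_zero 0) i)
    (h.isTridiagonalOn.finrank_below_le hs.isTridiagonalOn hirr (h.idem_ne_zero 0) i)

/-- If `d` exceeded `δ`, the flag of `B` would be exhausted at step `δ + 1`, hence so would that of
`A`, leaving no eigenspace for `θ (δ + 1)`. -/
theorem diameter_le (h : IsStandardEigenvalues A B θ) (hs : IsStandardEigenvalues B A θs)
    (hirr : ∀ W : Submodule K V, W.map A ≤ W → W.map B ≤ W → W = ⊥ ∨ W = ⊤) : d ≤ δ := by
  by_contra hlt
  have h1 := h.finrank_below_eq hs hirr (δ + 1)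
  rw [IsTridiagonalOn.below_eq_top B θs (Nat.lt_succ_self δ), finrank_top] at h1
  have h2 := Submodule.eq_top_of_finrank_eq h1
  refine h.idem_ne_zero ⟨δ + 1, by omega⟩ (LinearMap.ext fun x => ?_)
  have hx : x ∈ below A θ (δ + 1) := h2 ▸ Submodule.mem_top
  exact mem_below.1 hx _ le_rfl

theorem diameter_eq (h : IsStandardEigenvalues A B θ) (hs : IsStandardEigenvalues B A θs)
    (hirr : ∀ W : Submodule K V, W.map A ≤ W → W.map B ≤ W → W = ⊥ ∨ W = ⊤) : d = δ :=
  le_antisymm (h.diameter_le hs hirr) (hs.diameter_le h fun W h1 h2 => hirr W h2 h1)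

theorem finrank_eigenspace_eq {θs : Fin (d + 1) → K} (h : IsStandardEigenvalues A B θ)
    (hs : IsStandardEigenvalues B A θs)
    (hirr : ∀ W : Submodule K V, W.map A ≤ W → W.map B ≤ W → W = ⊥ ∨ W = ⊤) (i : Fin (d + 1)) :
    finrank K (A.eigenspace (θ i)) = finrank K (B.eigenspace (θs i)) := by
  have h1 := h.isTridiagonalOn.finrank_below_succ i
  have h2 := hs.isTridiagonalOn.finrank_below_succ i
  rw [h.finrank_below_eq hs hirr, h.finrank_below_eq hs hirr] at h1
  omega

end IsStandardEigenvalues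

theorem isSharp_of_finrank [FiniteDimensional K V] {A B : End K V}
    (hp : IsTridiagonalPair A B) {θ θs : Fin (d + 1) → K} (h : IsStandardEigenvalues A B θ)
    (hs : IsStandardEigenvalues B A θs) (h1 : finrank K (B.eigenspace (θs 0)) = 1) :
    IsSharp A B :=
  ⟨d, fun i => finrank K (B.eigenspace (θs i)), ⟨_, _, h.isStandardOrdering,
    hs.isStandardOrdering, fun i => ⟨h.finrank_eigenspace_eq hs hp.irreducible i, rfl⟩⟩, h1⟩

end StandardEigenvalues

/-! ### Commutativity of the whole corner. -/

section Corner

variable {K : Type*} [Field K] {R : Type*} [Ring R] [Algebra K R] {d : ℕ}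

/-- The corner `E^*_0 T E^*_0` is commutative. -/
theorem IsTridiagonalData.commute_corner_adjoin {a b : R} {θ θs : Fin (d + 1) → K}
    (h : IsTridiagonalData a b θ θs) {t t' : R} (ht : t ∈ Algebra.adjoin K {a, b})
    (ht' : t' ∈ Algebra.adjoin K {a, b}) :
    Commute (idem b θs 0 * t * idem b θs 0) (idem b θs 0 * t' * idem b θs 0) := by
  have h1 : ∀ s ∈ Algebra.adjoin K {a, b}, ∀ f : K[X],
      Commute (idem b θs 0 * aeval a f * idem b θs 0) (idem b θs 0 * s * idem b θs 0) := by
    intro s hs f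
    -- Centralizers are subalgebras, so generation upgrades commutation in two passes: generators
    -- against the corner, then the corner against itself.
    have := h.corner_mem (Subalgebra.centralizer K
      (Set.range fun f : K[X] => idem b θs 0 * aeval a f * idem b θs 0)) (fun f => by
        rw [Subalgebra.mem_centralizer_iff]
        rintro _ ⟨f', rfl⟩
        exact h.commute_corner f' f) hs
    exact (Subalgebra.mem_centralizer_iff K).1 this _ ⟨f, rfl⟩
  have := h.corner_mem (Subalgebra.centralizer K {idem b θs 0 * t * idem b θs 0}) (fun f => by
    rw [Subalgebra.mem_centralizer_iff]
    rintro _ rfl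
    exact (h1 t ht f).symm) ht'
  exact (Subalgebra.mem_centralizer_iff K).1 this _ rfl

end Corner

/-! ### Cyclic vectors, and sharpness over an algebraically closed field. -/

section Cyclic

variable {K : Type*} [Field K] {V : Type*} [AddCommGroup V] [Module K V] {d : ℕ}
  {A B : End K V}

theorem exists_mem_adjoin_apply_eq
    (hirr : ∀ W : Submodule K V, W.map A ≤ W → W.map B ≤ W → W = ⊥ ∨ W = ⊤) {v : V} (hv : v ≠ 0)
    (x : V) : ∃ t ∈ Algebra.adjoin K {A, B}, t v = x := by
  set N : Submodule K V := (Subalgebra.toSubmodule (Algebra.adjoin K {A, B})).map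
    (LinearMap.applyₗ v) with hN
  have hinv : ∀ C ∈ ({A, B} : Set (End K V)), N.map C ≤ N := by
    rintro C hC _ ⟨_, ⟨t, ht, rfl⟩, rfl⟩
    exact ⟨C * t, Subalgebra.mul_mem _ (Algebra.subset_adjoin hC) ht, rfl⟩
  have hvN : v ∈ N := ⟨1, Subalgebra.one_mem _, rfl⟩
  have htop : N = ⊤ := (hirr N (hinv A (by simp)) (hinv B (by simp))).resolve_left fun hb =>
    hv (by simpa [hb] using hvN)
  obtain ⟨t, ht, rfl⟩ : x ∈ N := htop ▸ Submodule.mem_top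
  exact ⟨t, ht, rfl⟩

/-- Over an algebraically closed field, `E^*_0 V` has dimension one. -/
theorem finrank_eigenspace_zero_of_isAlgClosed [IsAlgClosed K] [FiniteDimensional K V]
    {θ θs : Fin (d + 1) → K} (h : IsStandardEigenvalues A B θ) (hs : IsStandardEigenvalues B A θs)
    (hirr : ∀ W : Submodule K V, W.map A ≤ W → W.map B ≤ W → W = ⊥ ∨ W = ⊤) :
    finrank K (B.eigenspace (θs 0)) = 1 := by
  have hdata : IsTridiagonalData A B θ θs := ⟨h.isTridiagonalOn, hs.isTridiagonalOn⟩
  set e := idem B θs 0 with he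
  have hfix : ∀ u ∈ B.eigenspace (θs 0), e u = u := fun u hu => by
    rw [he, hs.idem_apply_of_mem hu, if_pos rfl]
  have hmem : ∀ x, e x ∈ B.eigenspace (θs 0) := fun x =>
    hs.isTridiagonalOn.range_idem 0 ▸ LinearMap.mem_range_self _ _
  have hnt : Nontrivial (B.eigenspace (θs 0)) := Submodule.nontrivial_iff_ne_bot.2 (hs.ne_bot 0)
  have hscalar : ∀ t ∈ Algebra.adjoin K {A, B}, ∃ c : K, ∀ u ∈ B.eigenspace (θs 0),
      e (t u) = c • u := by
    intro t ht
    -- A Schur argument: an eigenvector `v` of e t on E*_0 V generates V, and e t commutes with the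
    -- corner, so every vector of E*_0 V has the same eigenvalue.
    obtain ⟨c, hc⟩ := End.exists_eigenvalue
      ((e * t).restrict (p := B.eigenspace (θs 0)) (q := B.eigenspace (θs 0)) fun x _ => hmem _)
    obtain ⟨v, hv, hv0⟩ := hc.exists_hasEigenvector
    have hv' : e (t v) = c • (v : V) := by
      have := congrArg Subtype.val (End.mem_eigenspace_iff.1 hv)
      simpa using this
    have hv0' : (v : V) ≠ 0 := fun h => hv0 (Subtype.ext h)
    refine ⟨c, fun u hu => ?_⟩
    obtain ⟨t', ht', rfl⟩ := exists_mem_adjoin_apply_eq hirr hv0' u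
    have hcomm := congrArg (fun f : End K V => f v) (hdata.commute_corner_adjoin ht ht').eq
    simp only [End.mul_apply, ← he] at hcomm
    rw [hfix v v.2, hfix _ (hmem _), hfix _ (hmem _), hfix _ hu, hv', map_smul, map_smul,
      hfix _ hu] at hcomm
    exact hcomm
  obtain ⟨v, hv0⟩ := exists_ne (0 : B.eigenspace (θs 0))
  refine finrank_eq_one v hv0 fun w => ?_
  obtain ⟨t, ht, htw⟩ := exists_mem_adjoin_apply_eq hirr (fun h => hv0 (Subtype.ext h)) (w : V)
  obtain ⟨c, hc⟩ := hscalar t ht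
  refine ⟨c, Subtype.ext ?_⟩
  have := hc v v.2
  rw [htw, hfix _ w.2] at this
  exact this.symm

end Cyclic

/-! ### Isomorphisms as graphs in V × V'. -/

section Isomorphism

variable {K : Type*} [Field K] {d : ℕ}

/-- Polynomial identities in the product ring hold componentwise, so the corner theory applies to
both pairs at once. -/
theorem aeval_prod_mk {R R' : Type*} [Ring R] [Algebra K R] [Ring R'] [Algebra K R'] (a : R)
    (a' : R') (f : K[X]) : aeval (a, a') f = (aeval a f, aeval a' f) :=
  Prod.ext (aeval_algHom_apply (AlgHom.fst K R R') (a, a') f).symm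
    (aeval_algHom_apply (AlgHom.snd K R R') (a, a') f).symm

theorem idem_prod_mk {R R' : Type*} [Ring R] [Algebra K R] [Ring R'] [Algebra K R'] (a : R)
    (a' : R') (θ : Fin (d + 1) → K) (i : Fin (d + 1)) :
    idem (a, a') θ i = (idem a θ i, idem a' θ i) :=
  aeval_prod_mk a a' _

theorem IsTridiagonalOn.prod_mk {R R' : Type*} [Ring R] [Algebra K R] [Ring R'] [Algebra K R']
    {a b : R} {a' b' : R'} {θ : Fin (d + 1) → K} (h : IsTridiagonalOn a b θ)
    (h' : IsTridiagonalOn a' b' θ) : IsTridiagonalOn (a, a') (b, b') θ where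
  injective := h.injective
  nodal := by rw [aeval_prod_mk, h.nodal, h'.nodal]; rfl
  tri i j hij := by
    rw [idem_prod_mk, idem_prod_mk, Prod.mk_mul_mk, Prod.mk_mul_mk, h.tri i j hij, h'.tri i j hij]
    rfl

variable {V : Type*} [AddCommGroup V] [Module K V] {V' : Type*} [AddCommGroup V'] [Module K V']
  {A B : End K V} {A' B' : End K V'} {θ θs : Fin (d + 1) → K}

/-- The pairs of operators acting by a common scalar on two given subspaces. -/
def commonScalars (U : Submodule K V) (U' : Submodule K V') :
    Subalgebra K (End K V × End K V') where
  carrier := {Y | ∃ c : K, (∀ u ∈ U, Y.1 u = c • u) ∧ ∀ u ∈ U', Y.2 u = c • u}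
  mul_mem' := by
    rintro Y Z ⟨c, hc, hc'⟩ ⟨c₁, hc₁, hc₁'⟩
    refine ⟨c * c₁, fun u hu => ?_, fun u hu => ?_⟩
    · rw [Prod.fst_mul, End.mul_apply, hc₁ u hu, map_smul, hc u hu, smul_smul, mul_comm]
    · rw [Prod.snd_mul, End.mul_apply, hc₁' u hu, map_smul, hc' u hu, smul_smul, mul_comm]
  add_mem' := by
    rintro Y Z ⟨c, hc, hc'⟩ ⟨c₁, hc₁, hc₁'⟩
    refine ⟨c + c₁, fun u hu => ?_, fun u hu => ?_⟩
    · rw [Prod.fst_add, LinearMap.add_apply, hc₁ u hu, hc u hu, add_smul]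
    · rw [Prod.snd_add, LinearMap.add_apply, hc₁' u hu, hc' u hu, add_smul]
  algebraMap_mem' c := ⟨c, fun _ _ => rfl, fun _ _ => rfl⟩

/-- A submodule of `V × V'`, invariant under both pairs, on which the projections onto the two
irreducible factors are nonzero and have kernel other than the full factor, is the graph of an
isomorphism. -/
theorem pairIsomorphic_of_graph
    (hirr : ∀ W : Submodule K V, W.map A ≤ W → W.map B ≤ W → W = ⊥ ∨ W = ⊤)
    (hirr' : ∀ W : Submodule K V', W.map A' ≤ W → W.map B' ≤ W → W = ⊥ ∨ W = ⊤)
    (N : Submodule K (V × V')) (hA : ∀ x ∈ N, (A x.1, A' x.2) ∈ N)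
    (hB : ∀ x ∈ N, (B x.1, B' x.2) ∈ N)
    (h₁ : ∃ x ∈ N, x.1 ≠ 0) (h₂ : ∃ x ∈ N, x.2 ≠ 0)
    (h₃ : ∃ v, (v, (0 : V')) ∉ N) (h₄ : ∃ v, ((0 : V), v) ∉ N) :
    PairIsomorphic A B A' B' := by
  -- A Goursat argument: kernels and images of the two projections are invariant subspaces of
  -- irreducible modules.
  have hbot : N.comap (LinearMap.inl K V V') = ⊥ := by
    refine (hirr _ ?_ ?_).resolve_right ?_
    · rintro _ ⟨x, hx, rfl⟩
      simpa using hA _ hx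
    · rintro _ ⟨x, hx, rfl⟩
      simpa using hB _ hx
    · intro htop
      obtain ⟨v, hv⟩ := h₃
      exact hv (show v ∈ N.comap (LinearMap.inl K V V') from htop ▸ Submodule.mem_top)
  have hbot' : N.comap (LinearMap.inr K V V') = ⊥ := by
    refine (hirr' _ ?_ ?_).resolve_right ?_
    · rintro _ ⟨x, hx, rfl⟩
      simpa using hA _ hx
    · rintro _ ⟨x, hx, rfl⟩
      simpa using hB _ hx
    · intro htop
      obtain ⟨v, hv⟩ := h₄
      exact hv (show v ∈ N.comap (LinearMap.inr K V V') from htop ▸ Submodule.mem_top)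
  have htop : N.map (LinearMap.fst K V V') = ⊤ := by
    refine (hirr _ ?_ ?_).resolve_left ?_
    · rintro _ ⟨_, ⟨x, hx, rfl⟩, rfl⟩
      exact ⟨_, hA x hx, rfl⟩
    · rintro _ ⟨_, ⟨x, hx, rfl⟩, rfl⟩
      exact ⟨_, hB x hx, rfl⟩
    · intro hb
      obtain ⟨x, hx, hx0⟩ := h₁
      exact hx0 ((Submodule.mem_bot K).1 (hb ▸ Submodule.mem_map_of_mem hx))
  have htop' : N.map (LinearMap.snd K V V') = ⊤ := by
    refine (hirr' _ ?_ ?_).resolve_left ?_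
    · rintro _ ⟨_, ⟨x, hx, rfl⟩, rfl⟩
      exact ⟨_, hA x hx, rfl⟩
    · rintro _ ⟨_, ⟨x, hx, rfl⟩, rfl⟩
      exact ⟨_, hB x hx, rfl⟩
    · intro hb
      obtain ⟨x, hx, hx0⟩ := h₂
      exact hx0 ((Submodule.mem_bot K).1 (hb ▸ Submodule.mem_map_of_mem hx))
  have bij₁ : Function.Bijective ((LinearMap.fst K V V').comp N.subtype) := by
    constructor
    · rw [← LinearMap.ker_eq_bot, LinearMap.ker_eq_bot']
      rintro ⟨⟨x, y⟩, hxy⟩ h0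
      obtain rfl : x = 0 := h0
      have : y ∈ N.comap (LinearMap.inr K V V') := hxy
      rw [hbot', Submodule.mem_bot] at this
      subst this
      rfl
    · intro x
      obtain ⟨y, hy, rfl⟩ : x ∈ N.map (LinearMap.fst K V V') := htop ▸ Submodule.mem_top
      exact ⟨⟨y, hy⟩, rfl⟩
  have bij₂ : Function.Bijective ((LinearMap.snd K V V').comp N.subtype) := by
    constructor
    · rw [← LinearMap.ker_eq_bot, LinearMap.ker_eq_bot']
      rintro ⟨⟨x, y⟩, hxy⟩ h0
      obtain rfl : y = 0 := h0
      have : x ∈ N.comap (LinearMap.inl K V V') := hxy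
      rw [hbot, Submodule.mem_bot] at this
      subst this
      rfl
    · intro x
      obtain ⟨y, hy, rfl⟩ : x ∈ N.map (LinearMap.snd K V V') := htop' ▸ Submodule.mem_top
      exact ⟨⟨y, hy⟩, rfl⟩
  set p₁ := LinearEquiv.ofBijective _ bij₁ with hp₁
  set p₂ := LinearEquiv.ofBijective _ bij₂ with hp₂
  have hγ : ∀ x : N, (p₁.symm.trans p₂) x.1.1 = x.1.2 := fun x => by
    have : p₁ x = x.1.1 := rfl
    rw [LinearEquiv.trans_apply, ← this, LinearEquiv.symm_apply_apply]
    rfl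
  refine ⟨p₁.symm.trans p₂, fun v => ?_, fun v => ?_⟩
  · obtain ⟨x, rfl⟩ := p₁.surjective v
    have e1 := hγ x
    have e2 := hγ ⟨_, hA x x.2⟩
    change (p₁.symm.trans p₂) (A x.1.1) = A' ((p₁.symm.trans p₂) x.1.1)
    rw [e1, e2]
  · obtain ⟨x, rfl⟩ := p₁.surjective v
    have e1 := hγ x
    have e2 := hγ ⟨_, hB x x.2⟩
    change (p₁.symm.trans p₂) (B x.1.1) = B' ((p₁.symm.trans p₂) x.1.1)
    rw [e1, e2]

/-- Two pairs for which `E^*_0 D E^*_0` acts on `E^*_0 V` by the same scalars are isomorphic. -/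
theorem pairIsomorphic_of_corner
    (h : IsStandardEigenvalues A B θ) (hs : IsStandardEigenvalues B A θs)
    (h' : IsStandardEigenvalues A' B' θ) (hs' : IsStandardEigenvalues B' A' θs)
    (hirr : ∀ W : Submodule K V, W.map A ≤ W → W.map B ≤ W → W = ⊥ ∨ W = ⊤)
    (hirr' : ∀ W : Submodule K V', W.map A' ≤ W → W.map B' ≤ W → W = ⊥ ∨ W = ⊤)
    (hc : ∀ f : K[X], ∃ c : K,
      (∀ u ∈ B.eigenspace (θs 0), idem B θs 0 (aeval A f u) = c • u) ∧
      ∀ u ∈ B'.eigenspace (θs 0), idem B' θs 0 (aeval A' f u) = c • u) :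
    PairIsomorphic A B A' B' := by
  have hdata : IsTridiagonalData (A, A') (B, B') θ θs :=
    ⟨h.isTridiagonalOn.prod_mk h'.isTridiagonalOn, hs.isTridiagonalOn.prod_mk hs'.isTridiagonalOn⟩
  have hfix : ∀ u ∈ B.eigenspace (θs 0), idem B θs 0 u = u := fun u hu => by
    rw [hs.idem_apply_of_mem hu, if_pos rfl]
  have hfix' : ∀ u ∈ B'.eigenspace (θs 0), idem B' θs 0 u = u := fun u hu => by
    rw [hs'.idem_apply_of_mem hu, if_pos rfl]
  have hcorner : ∀ t ∈ Algebra.adjoin K {(A, A'), (B, B')}, ∃ c : K,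
      (∀ u ∈ B.eigenspace (θs 0), idem B θs 0 (t.1 u) = c • u) ∧
      ∀ u ∈ B'.eigenspace (θs 0), idem B' θs 0 (t.2 u) = c • u := by
    intro t ht
    obtain ⟨c, h1, h2⟩ := hdata.corner_mem
      (commonScalars (B.eigenspace (θs 0)) (B'.eigenspace (θs 0))) (fun f => by
        obtain ⟨c, h1, h2⟩ := hc f
        refine ⟨c, fun u hu => ?_, fun u hu => ?_⟩
        · rw [← h1 u hu, idem_prod_mk, aeval_prod_mk]
          simp [hfix u hu]
        · rw [← h2 u hu, idem_prod_mk, aeval_prod_mk]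
          simp [hfix' u hu]) ht
    refine ⟨c, fun u hu => ?_, fun u hu => ?_⟩
    · rw [← h1 u hu, idem_prod_mk]
      simp [hfix u hu]
    · rw [← h2 u hu, idem_prod_mk]
      simp [hfix' u hu]
  obtain ⟨v, hv, hv0⟩ := Submodule.exists_mem_ne_zero_of_ne_bot (hs.ne_bot 0)
  obtain ⟨v', hv', hv0'⟩ := Submodule.exists_mem_ne_zero_of_ne_bot (hs'.ne_bot 0)
  set L : End K V × End K V' →ₗ[K] V × V' :=
    (LinearMap.applyₗ v).prodMap (LinearMap.applyₗ v') with hL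
  set N : Submodule K (V × V') :=
    (Subalgebra.toSubmodule (Algebra.adjoin K {(A, A'), (B, B')})).map L with hN
  have hinv : ∀ C ∈ ({(A, A'), (B, B')} : Set (End K V × End K V')), ∀ x ∈ N,
      (C.1 x.1, C.2 x.2) ∈ N := by
    rintro C hC _ ⟨t, ht, rfl⟩
    exact ⟨C * t, Subalgebra.mul_mem _ (Algebra.subset_adjoin hC) ht, rfl⟩
  have hvN : (v, v') ∈ N := ⟨1, Subalgebra.one_mem _, rfl⟩
  -- The shared scalar is what rules out `(v, 0)` and `(0, v')`: a zero component forces `c = 0`.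
  have hproj : ∀ x ∈ N, ∃ c : K, idem B θs 0 x.1 = c • v ∧ idem B' θs 0 x.2 = c • v' := by
    rintro _ ⟨t, ht, rfl⟩
    obtain ⟨c, h1, h2⟩ := hcorner t ht
    exact ⟨c, h1 v hv, h2 v' hv'⟩
  refine pairIsomorphic_of_graph hirr hirr' N (hinv (A, A') (by simp)) (hinv (B, B') (by simp))
    ⟨_, hvN, hv0⟩ ⟨_, hvN, hv0'⟩ ⟨v, fun hmem => ?_⟩ ⟨v', fun hmem => ?_⟩
  · obtain ⟨c, h1, h2⟩ := hproj _ hmem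
    have hc0 : c = 0 := by simpa [hv0'] using h2.symm
    rw [hc0, zero_smul, hfix v hv] at h1
    exact hv0 h1
  · obtain ⟨c, h1, h2⟩ := hproj _ hmem
    have hc0 : c = 0 := by simpa [hv0] using h1.symm
    rw [hc0, zero_smul, hfix' v' hv'] at h2
    exact hv0' h2

end Isomorphism

/-! ### Parameter arrays and the scalars of the corner. -/

section ParameterArrays

variable {K : Type*} [Field K] {d : ℕ}

/-- Newton interpolation: a space of polynomials containing all `(X - θ 0) ⋯ (X - θ (i - 1))`
attains all values at the nodes. -/
theorem exists_mem_eval_eq {θ : Fin (d + 1) → K} (hθ : Function.Injective θ)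
    (P : Submodule K K[X]) (hP : ∀ i : Fin (d + 1), ∏ j ∈ Finset.Iio i, (X - C (θ j)) ∈ P)
    (f : K[X]) : ∃ g ∈ P, ∀ k, f.eval (θ k) = g.eval (θ k) := by
  suffices H : ∀ n : ℕ, ∃ g ∈ P, ∀ k : Fin (d + 1), (k : ℕ) < n → f.eval (θ k) = g.eval (θ k) by
    obtain ⟨g, hg, hgk⟩ := H (d + 1)
    exact ⟨g, hg, fun k => hgk k k.isLt⟩
  intro n
  induction n with
  | zero => exact ⟨0, P.zero_mem, fun k hk => absurd hk (Nat.not_lt_zero _)⟩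
  | succ n ih =>
    obtain ⟨g, hg, hgk⟩ := ih
    by_cases hn : n < d + 1
    · set i : Fin (d + 1) := ⟨n, hn⟩ with hi
      set τ : K[X] := ∏ j ∈ Finset.Iio i, (X - C (θ j)) with hτ
      have hτi : τ.eval (θ i) ≠ 0 := by
        rw [hτ, eval_prod, Finset.prod_ne_zero_iff]
        intro j hj
        rw [eval_sub, eval_X, eval_C]
        exact sub_ne_zero.2 (hθ.ne (Finset.mem_Iio.1 hj).ne')
      -- The Newton step: `τ` vanishes at the earlier nodes and not at `θ i`.
      refine ⟨g + ((f.eval (θ i) - g.eval (θ i)) / τ.eval (θ i)) • τ,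
        P.add_mem hg (P.smul_mem _ (hP i)), fun k hk => ?_⟩
      rcases Nat.lt_succ_iff_lt_or_eq.1 hk with hk | hk
      · have hτk : τ.eval (θ k) = 0 := by
          rw [hτ, eval_prod]
          exact Finset.prod_eq_zero (Finset.mem_Iio.2 (show k < i from hk)) (by simp)
        simp [hτk, hgk k hk]
      · obtain rfl : k = i := Fin.ext hk
        rw [eval_add, eval_smul, smul_eq_mul, div_mul_cancel₀ _ hτi]
        ring
    · exact ⟨g, hg, fun k _ => hgk k (by omega)⟩

variable {V : Type*} [AddCommGroup V] [Module K V] {V' : Type*} [AddCommGroup V'] [Module K V']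
  {A B : End K V} {A' B' : End K V'} {θ θs : Fin (d + 1) → K}

/-- On `E^*_0 V`, the operator defining `ζ i` is a nonzero multiple of
`E^*_0 (A - θ 0) ⋯ (A - θ (i - 1))`. -/
theorem aeval_aeval_eq_smul_idem
    (hs : IsStandardEigenvalues B A θs) (i : Fin (d + 1)) {u : V}
    (hu : u ∈ B.eigenspace (θs 0)) :
    aeval B (∏ j ∈ Finset.Ioc 0 i, (X - C (θs j)))
        (aeval A (∏ j ∈ Finset.Iio i, (X - C (θ j))) u) =
      (∏ j ∈ Finset.Ioc 0 i, (θs 0 - θs j)) •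
        idem B θs 0 (aeval A (∏ j ∈ Finset.Iio i, (X - C (θ j))) u) := by
  have hdeg : (∏ j ∈ Finset.Iio i, (X - C (θ j))).degree <
      (((i : ℕ) + 1 : ℕ) : WithBot ℕ) := by
    rw [← Lagrange.nodal_eq, Lagrange.degree_nodal, Fin.card_Iio]
    exact_mod_cast Nat.lt_succ_self _
  -- In the expansion over E*_k, terms with `0 < k ≤ i` vanish through a factor of the product and
  -- those with `k > i` because the polynomial in `A` has degree `i`; only `k = 0` remains.
  rw [hs.isTridiagonalOn.aeval_eq_sum (∏ j ∈ Finset.Ioc 0 i, (X - C (θs j))),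
    LinearMap.sum_apply, Finset.sum_eq_single 0]
  · rw [eval_prod]
    simp
  · intro k _ hk
    rw [LinearMap.smul_apply]
    by_cases hki : k ≤ i
    · have : (∏ j ∈ Finset.Ioc 0 i, (X - C (θs j))).eval (θs k) = 0 := by
        rw [eval_prod]
        exact Finset.prod_eq_zero (Finset.mem_Ioc.2 ⟨Fin.pos_iff_ne_zero.2 hk, hki⟩) (by simp)
      rw [this, zero_smul]
    · have h1 := congrArg (fun f : End K V => f u) (hs.isTridiagonalOn.idem_mul_aeval_mul_idem hdeg
        (i := k) (j := 0) (Or.inr (by simpa using hki)))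
      simp only [End.mul_apply, LinearMap.zero_apply] at h1
      rw [hs.idem_apply_of_mem hu, if_pos rfl] at h1
      rw [h1, smul_zero]
  · simp

theorem prod_sub_ne_zero (hinj : Function.Injective θs) (i : Fin (d + 1)) :
    ∏ j ∈ Finset.Ioc 0 i, (θs 0 - θs j) ≠ 0 :=
  Finset.prod_ne_zero_iff.2 fun _ hj => sub_ne_zero.2 (hinj.ne (Finset.mem_Ioc.1 hj).1.ne)

theorem IsStandardIdempotents.exists_eigenvalues {E : Fin (d + 1) → End K V}
    (hE : IsStandardIdempotents A B E) (hA : IsDiagonalizable A) :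
    ∃ θ : Fin (d + 1) → K, IsStandardEigenvalues A B θ ∧ ∀ i, E i = idem A θ i := by
  obtain ⟨W, hW, h1, h2⟩ := hE
  obtain ⟨θ, hθ⟩ := hW.exists_eigenvalues
  have h := hW.isStandardEigenvalues hA hθ
  refine ⟨θ, h, fun i => h.end_ext fun j x hx => ?_⟩
  rw [h.idem_apply_of_mem hx]
  rw [← hθ] at hx
  split_ifs with hij
  · subst hij
    exact h1 i x hx
  · exact h2 i j (Ne.symm hij) x hx

/-- A nonzero eigenspace determines its eigenvalue, so the scalars prescribed by a parameter array
are the eigenvalues of the ordering behind `E`. -/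
theorem IsStandardIdempotents.of_range_eq {E : Fin (d + 1) → End K V}
    (hE : IsStandardIdempotents A B E) (hA : IsDiagonalizable A)
    (hθ : ∀ i, LinearMap.range (E i) = A.eigenspace (θ i)) :
    IsStandardEigenvalues A B θ ∧ ∀ i, E i = idem A θ i := by
  obtain ⟨φ, h, hEφ⟩ := hE.exists_eigenvalues hA
  have : φ = θ := by
    funext i
    have h1 : A.eigenspace (φ i) = A.eigenspace (θ i) := by
      rw [← hθ, hEφ, h.isTridiagonalOn.range_idem]
    obtain ⟨x, hx, hx0⟩ := Submodule.exists_mem_ne_zero_of_ne_bot (h.ne_bot i)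
    have e1 := End.mem_eigenspace_iff.1 hx
    rw [h1, End.mem_eigenspace_iff, e1] at hx
    exact smul_left_injective K hx0 hx
  exact this ▸ ⟨h, hEφ⟩

namespace TridiagonalSystem

theorem splitSpace_zero (Φ : TridiagonalSystem K V d)
    (h : IsStandardEigenvalues Φ.A Φ.As θ) (hs : IsStandardEigenvalues Φ.As Φ.A θs)
    (hE : ∀ i, Φ.E i = idem Φ.A θ i) (hEs : ∀ i, Φ.Es i = idem Φ.As θs i) :
    Φ.splitSpace 0 = Φ.As.eigenspace (θs 0) := by
  have h1 : (⨆ j : Fin (d + 1), ⨆ _ : j ≤ 0, LinearMap.range (Φ.Es j)) =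
      Φ.As.eigenspace (θs 0) := by
    apply le_antisymm
    · refine iSup₂_le fun j hj => ?_
      rw [Fin.le_zero_iff.1 hj, hEs, hs.isTridiagonalOn.range_idem]
    · refine le_iSup₂_of_le 0 le_rfl ?_
      rw [hEs, hs.isTridiagonalOn.range_idem]
  have h2 : (⨆ j : Fin (d + 1), ⨆ _ : 0 ≤ j, LinearMap.range (Φ.E j)) = ⊤ := by
    simp only [Fin.zero_le, iSup_pos, hE, h.isTridiagonalOn.range_idem, h.iSup_eq_top]
  rw [splitSpace, h1, h2, inf_top_eq]

theorem isParameterArray [FiniteDimensional K V] (Φ : TridiagonalSystem K V d)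
    (h : IsStandardEigenvalues Φ.A Φ.As θ) (hs : IsStandardEigenvalues Φ.As Φ.A θs)
    (hE : ∀ i, Φ.E i = idem Φ.A θ i) (hEs : ∀ i, Φ.Es i = idem Φ.As θs i)
    (h1 : finrank K (Φ.As.eigenspace (θs 0)) = 1) (z : Fin (d + 1) → K)
    (hz : ∀ i, ∀ u ∈ Φ.As.eigenspace (θs 0),
      idem Φ.As θs 0 (aeval Φ.A (∏ j ∈ Finset.Iio i, (X - C (θ j))) u) = z i • u) :
    Φ.IsParameterArray ⟨θ, θs, fun i => (∏ j ∈ Finset.Ioc 0 i, (θs 0 - θs j)) * z i⟩ where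
  sharp := isSharp_of_finrank Φ.isTridiagonalPair h hs h1
  eigenvalue i := by rw [hE, h.isTridiagonalOn.range_idem]
  eigenvalue_star i := by rw [hEs, hs.isTridiagonalOn.range_idem]
  split i u hu := by
    rw [Φ.splitSpace_zero h hs hE hEs] at hu
    rw [upDown, End.mul_apply, aeval_aeval_eq_smul_idem hs i hu, hz i u hu, smul_smul]

/-- Systems with the same parameter array have isomorphic pairs. -/
theorem pairIsomorphic_of_isParameterArray {Φ : TridiagonalSystem K V d}
    {Φ' : TridiagonalSystem K V' d} {p : ParameterArray K d}
    (hp : Φ.IsParameterArray p) (hp' : Φ'.IsParameterArray p) :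
    PairIsomorphic Φ.A Φ.As Φ'.A Φ'.As := by
  obtain ⟨h, hE⟩ := Φ.standard.of_range_eq Φ.isTridiagonalPair.diagonalizable_left hp.eigenvalue
  obtain ⟨hs, hEs⟩ :=
    Φ.standard_star.of_range_eq Φ.isTridiagonalPair.diagonalizable_right hp.eigenvalue_star
  obtain ⟨h', hE'⟩ :=
    Φ'.standard.of_range_eq Φ'.isTridiagonalPair.diagonalizable_left hp'.eigenvalue
  obtain ⟨hs', hEs'⟩ :=
    Φ'.standard_star.of_range_eq Φ'.isTridiagonalPair.diagonalizable_right hp'.eigenvalue_star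
  refine pairIsomorphic_of_corner h hs h' hs' Φ.isTridiagonalPair.irreducible
    Φ'.isTridiagonalPair.irreducible fun f => ?_
  -- The polynomials acting by a common scalar form a subspace; it suffices that it contains the
  -- Newton polynomials.
  let P : Submodule K K[X] :=
    { carrier := {f | ∃ c : K,
        (∀ u ∈ Φ.As.eigenspace (p.θs 0), idem Φ.As p.θs 0 (aeval Φ.A f u) = c • u) ∧
        ∀ u ∈ Φ'.As.eigenspace (p.θs 0), idem Φ'.As p.θs 0 (aeval Φ'.A f u) = c • u}
      zero_mem' := ⟨0, by simp, by simp⟩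
      add_mem' := by
        rintro f g ⟨c, h1, h2⟩ ⟨c', h1', h2'⟩
        refine ⟨c + c', fun u hu => ?_, fun u hu => ?_⟩
        · rw [map_add, LinearMap.add_apply, map_add, h1 u hu, h1' u hu, add_smul]
        · rw [map_add, LinearMap.add_apply, map_add, h2 u hu, h2' u hu, add_smul]
      smul_mem' := by
        rintro r f ⟨c, h1, h2⟩
        refine ⟨r * c, fun u hu => ?_, fun u hu => ?_⟩
        · rw [map_smul, LinearMap.smul_apply, map_smul, h1 u hu, smul_smul]
        · rw [map_smul, LinearMap.smul_apply, map_smul, h2 u hu, smul_smul] }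
  obtain ⟨g, ⟨c, h1, h2⟩, hg⟩ := exists_mem_eval_eq h.injective P (fun i => by
    have hne := prod_sub_ne_zero hs.injective i
    -- The scalar is `ζ i` divided by the factor of `aeval_aeval_eq_smul_idem`, the same for both
    -- systems.
    refine ⟨(∏ j ∈ Finset.Ioc 0 i, (p.θs 0 - p.θs j))⁻¹ * p.ζ i, fun u hu => ?_, fun u hu => ?_⟩
    · have := hp.split i u (by rwa [Φ.splitSpace_zero h hs hE hEs])
      rw [upDown, End.mul_apply, aeval_aeval_eq_smul_idem hs i hu] at this
      rw [mul_smul, ← this, inv_smul_smul₀ hne]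
    · have := hp'.split i u (by rwa [Φ'.splitSpace_zero h' hs' hE' hEs'])
      rw [upDown, End.mul_apply, aeval_aeval_eq_smul_idem hs' i hu] at this
      rw [mul_smul, ← this, inv_smul_smul₀ hne]) f
  refine ⟨c, fun u hu => ?_, fun u hu => ?_⟩
  · rw [h.isTridiagonalOn.aeval_eq_of_eval_eq hg, h1 u hu]
  · rw [h'.isTridiagonalOn.aeval_eq_of_eval_eq hg, h2 u hu]

/-- The system attached to eigenvalues in standard order. -/
noncomputable def ofEigenvalues (hp : IsTridiagonalPair A B) (h : IsStandardEigenvalues A B θ)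
    (hs : IsStandardEigenvalues B A θs) : TridiagonalSystem K V d :=
  ⟨A, idem A θ, B, idem B θs, hp, h.isStandardIdempotents, hs.isStandardIdempotents⟩

end TridiagonalSystem

/-! ### Transport of eigenvalues and parameter arrays along an isomorphism. -/

section Transport

variable (γ : V ≃ₗ[K] V') (hA : ∀ v, γ (A v) = A' (γ v)) (hB : ∀ v, γ (B v) = B' (γ v))

include hA

theorem map_aeval_apply (f : K[X]) (v : V) : γ (aeval A f v) = aeval A' f (γ v) := by
  induction f using Polynomial.induction_on' generalizing v with
  | add f g hf hg => simp [hf, hg]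
  | monomial n c =>
    have hpow : ∀ (n : ℕ) (v : V), γ ((A ^ n) v) = (A' ^ n) (γ v) := by
      intro n
      induction n with
      | zero => simp
      | succ n ih =>
        intro v
        rw [pow_succ, pow_succ, End.mul_apply, End.mul_apply, ih, hA]
    simp [aeval_monomial, hpow]

theorem map_eigenspace (μ : K) :
    (A.eigenspace μ).map γ.toLinearMap = A'.eigenspace μ := by
  ext x
  constructor
  · rintro ⟨y, hy, rfl⟩
    rw [End.mem_eigenspace_iff, LinearEquiv.coe_coe, ← hA, End.mem_eigenspace_iff.1 hy, map_smul]
  · intro hx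
    refine ⟨γ.symm x, End.mem_eigenspace_iff.2 (γ.injective ?_), by simp⟩
    rw [hA, LinearEquiv.apply_symm_apply, End.mem_eigenspace_iff.1 hx, map_smul,
      LinearEquiv.apply_symm_apply]

theorem finrank_eigenspace_congr (μ : K) :
    finrank K (A'.eigenspace μ) = finrank K (A.eigenspace μ) := by
  rw [← map_eigenspace γ hA μ]
  exact γ.finrank_map_eq _

include hB

theorem IsStandardEigenvalues.map (h : IsStandardEigenvalues A B θ) :
    IsStandardEigenvalues A' B' θ where
  injective := h.injective
  ne_bot i := by
    rw [← map_eigenspace γ hA]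
    exact fun hbot => h.ne_bot i (Submodule.map_injective_of_injective γ.injective
      (hbot.trans (Submodule.map_bot _).symm))
  iSup_eq_top := by
    simp only [← map_eigenspace γ hA]
    rw [← Submodule.map_iSup, h.iSup_eq_top, Submodule.map_top]
    exact γ.range
  tridiagonal i := by
    simp only [← map_eigenspace γ hA]
    rintro _ ⟨_, ⟨x, hx, rfl⟩, rfl⟩
    rw [LinearEquiv.coe_coe, ← hB]
    simp only [← Submodule.map_iSup]
    exact Submodule.mem_map_of_mem (h.tridiagonal i (Submodule.mem_map_of_mem hx))

/-- Systems attached to isomorphic pairs and the same eigenvalues share a parameter array. -/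
theorem TridiagonalSystem.exists_common_isParameterArray [FiniteDimensional K V]
    [FiniteDimensional K V'] (h : IsStandardEigenvalues A B θ)
    (hs : IsStandardEigenvalues B A θs) (h1 : finrank K (B.eigenspace (θs 0)) = 1) :
    ∃ p : ParameterArray K d,
      (∀ Φ : TridiagonalSystem K V d, Φ.A = A → Φ.As = B → (∀ i, Φ.E i = idem A θ i) →
        (∀ i, Φ.Es i = idem B θs i) → Φ.IsParameterArray p) ∧
      (∀ Φ : TridiagonalSystem K V' d, Φ.A = A' → Φ.As = B' → (∀ i, Φ.E i = idem A' θ i) →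
        (∀ i, Φ.Es i = idem B' θs i) → Φ.IsParameterArray p) := by
  have hz : ∀ i : Fin (d + 1), ∃ z : K, ∀ u ∈ B.eigenspace (θs 0),
      idem B θs 0 (aeval A (∏ j ∈ Finset.Iio i, (X - C (θ j))) u) = z • u := by
    intro i
    obtain ⟨v, hv0, hv⟩ := finrank_eq_one_iff'.1 h1
    obtain ⟨z, hz⟩ := hv ⟨idem B θs 0 (aeval A (∏ j ∈ Finset.Iio i, (X - C (θ j))) v),
      hs.isTridiagonalOn.range_idem 0 ▸ LinearMap.mem_range_self _ _⟩
    have hz' : z • (v : V) = idem B θs 0 (aeval A (∏ j ∈ Finset.Iio i, (X - C (θ j))) v) :=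
      congrArg Subtype.val hz
    refine ⟨z, fun u hu => ?_⟩
    obtain ⟨c, hc⟩ := hv ⟨u, hu⟩
    have hc' : c • (v : V) = u := congrArg Subtype.val hc
    rw [← hc', map_smul, map_smul, ← hz', smul_comm]
  choose z hz using hz
  refine ⟨⟨θ, θs, fun i => (∏ j ∈ Finset.Ioc 0 i, (θs 0 - θs j)) * z i⟩, ?_, ?_⟩
  · rintro Φ rfl rfl hE hEs
    exact Φ.isParameterArray h hs hE hEs h1 z hz
  · rintro Φ rfl rfl hE hEs
    refine Φ.isParameterArray (h.map γ hA hB) (hs.map γ hB hA) hE hEs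
      ((finrank_eigenspace_congr γ hB _).trans h1) z fun i u hu => ?_
    rw [← map_eigenspace γ hB] at hu
    obtain ⟨u, hu, rfl⟩ := hu
    rw [LinearEquiv.coe_coe, ← map_aeval_apply γ hA, idem, ← map_aeval_apply γ hB, ← idem,
      hz i u hu, map_smul]

theorem haveCommonParameterArray_of_equiv [FiniteDimensional K V]
    [FiniteDimensional K V'] (hp : IsTridiagonalPair A B) (hp' : IsTridiagonalPair A' B')
    (h : IsStandardEigenvalues A B θ)
    (hs : IsStandardEigenvalues B A θs) (h1 : finrank K (B.eigenspace (θs 0)) = 1) :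
    HaveCommonParameterArray A B A' B' := by
  obtain ⟨p, h2, h3⟩ := TridiagonalSystem.exists_common_isParameterArray γ hA hB h hs h1
  exact ⟨d, p, ⟨.ofEigenvalues hp h hs, rfl, rfl, h2 _ rfl rfl (fun _ => rfl) fun _ => rfl⟩,
    ⟨.ofEigenvalues hp' (h.map γ hA hB) (hs.map γ hB hA), rfl, rfl,
      h3 _ rfl rfl (fun _ => rfl) fun _ => rfl⟩⟩

end Transport

theorem pairIsomorphic_of_haveCommonParameterArray
    (h : HaveCommonParameterArray A B A' B') :
    PairIsomorphic A B A' B' := by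
  obtain ⟨d, p, ⟨Φ, rfl, rfl, hp⟩, ⟨Φ', rfl, rfl, hp'⟩⟩ := h
  exact TridiagonalSystem.pairIsomorphic_of_isParameterArray hp hp'

theorem pairIsomorphic_iff_of_isSharp [FiniteDimensional K V]
    [FiniteDimensional K V'] (hp : IsTridiagonalPair A B) (hp' : IsTridiagonalPair A' B')
    (hsharp : IsSharp A B) :
    PairIsomorphic A B A' B' ↔ HaveCommonParameterArray A B A' B' := by
  refine ⟨?_, pairIsomorphic_of_haveCommonParameterArray⟩
  rintro ⟨γ, hA, hB⟩
  obtain ⟨d, ρ, ⟨W, W', hW, hW', hρ⟩, hρ0⟩ := hsharp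
  obtain ⟨θ, hθ⟩ := hW.exists_eigenvalues
  obtain ⟨θs, hθs⟩ := hW'.exists_eigenvalues
  exact haveCommonParameterArray_of_equiv γ hA hB hp hp'
    (hW.isStandardEigenvalues hp.diagonalizable_left hθ)
    (hW'.isStandardEigenvalues hp.diagonalizable_right hθs) (by rw [← hθs, (hρ 0).2, hρ0])

/-- Over an algebraically closed field every tridiagonal pair is sharp. -/
theorem IsTridiagonalPair.isSharp [IsAlgClosed K] [FiniteDimensional K V]
    (hp : IsTridiagonalPair A B) : IsSharp A B := by
  obtain ⟨d, W, hW⟩ := hp.exists_ordering_left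
  obtain ⟨δ, W', hW'⟩ := hp.exists_ordering_right
  obtain ⟨θ, hθ⟩ := hW.exists_eigenvalues
  obtain ⟨θs, hθs⟩ := hW'.exists_eigenvalues
  have h := hW.isStandardEigenvalues hp.diagonalizable_left hθ
  have hs := hW'.isStandardEigenvalues hp.diagonalizable_right hθs
  obtain rfl := h.diameter_eq hs hp.irreducible
  exact isSharp_of_finrank hp h hs (finrank_eigenspace_zero_of_isAlgClosed h hs hp.irreducible)

/-- The idempotents are polynomials in A and A* determined by the array, so an isomorphism of pairs
intertwines them automatically. -/
theorem TridiagonalSystem.isomorphic_of_isParameterArray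
    {Φ : TridiagonalSystem K V d} {Φ' : TridiagonalSystem K V' d}
    {p : ParameterArray K d} (hp : Φ.IsParameterArray p) (hp' : Φ'.IsParameterArray p) :
    Φ.Isomorphic Φ' := by
  obtain ⟨γ, hA, hB⟩ := pairIsomorphic_of_isParameterArray hp hp'
  have hE := (Φ.standard.of_range_eq Φ.isTridiagonalPair.diagonalizable_left hp.eigenvalue).2
  have hEs := (Φ.standard_star.of_range_eq Φ.isTridiagonalPair.diagonalizable_right
    hp.eigenvalue_star).2
  have hE' := (Φ'.standard.of_range_eq Φ'.isTridiagonalPair.diagonalizable_left hp'.eigenvalue).2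
  have hEs' := (Φ'.standard_star.of_range_eq Φ'.isTridiagonalPair.diagonalizable_right
    hp'.eigenvalue_star).2
  refine ⟨rfl, γ, hA, hB, fun i j hij => ?_⟩
  obtain rfl : i = j := Fin.ext hij
  refine ⟨fun v => ?_, fun v => ?_⟩
  · rw [hE, hE']
    exact map_aeval_apply γ hA _ v
  · rw [hEs, hEs']
    exact map_aeval_apply γ hB _ v

theorem TridiagonalSystem.isomorphic_iff [IsAlgClosed K] [FiniteDimensional K V]
    [FiniteDimensional K V'] {d' : ℕ} (Φ : TridiagonalSystem K V d)
    (Φ' : TridiagonalSystem K V' d') : Φ.Isomorphic Φ' ↔ Φ.SameParameterArray Φ' := by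
  constructor
  · rintro ⟨rfl, γ, hA, hB, hγ⟩
    obtain ⟨θ, h, hE⟩ :=
      Φ.standard.exists_eigenvalues Φ.isTridiagonalPair.diagonalizable_left
    obtain ⟨θs, hs, hEs⟩ :=
      Φ.standard_star.exists_eigenvalues Φ.isTridiagonalPair.diagonalizable_right
    obtain ⟨p, h2, h3⟩ := exists_common_isParameterArray γ hA hB h hs
      (finrank_eigenspace_zero_of_isAlgClosed h hs Φ.isTridiagonalPair.irreducible)
    refine ⟨rfl, p, h2 Φ rfl rfl hE hEs, h3 Φ' rfl rfl (fun i => ?_) fun i => ?_⟩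
    · refine LinearMap.ext fun x => ?_
      obtain ⟨v, rfl⟩ := γ.surjective x
      rw [← (hγ i i rfl).1 v, hE]
      exact map_aeval_apply γ hA _ v
    · refine LinearMap.ext fun x => ?_
      obtain ⟨v, rfl⟩ := γ.surjective x
      rw [← (hγ i i rfl).2 v, hEs]
      exact map_aeval_apply γ hB _ v
  · rintro ⟨rfl, p, hp, hp'⟩
    exact isomorphic_of_isParameterArray hp hp'

end ParameterArrays

end Tridiagonal

theorem theorem5p7 (K : Type*) [Field K]
    (V : Type*) [AddCommGroup V] [Module K V] [FiniteDimensional K V] [Nontrivial V]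
    (V' : Type*) [AddCommGroup V'] [Module K V'] [FiniteDimensional K V'] [Nontrivial V'] :
    (∀ (A As : Module.End K V) (A' As' : Module.End K V'),
      Tridiagonal.IsTridiagonalPair A As → Tridiagonal.IsTridiagonalPair A' As' →
      Tridiagonal.IsSharp A As → Tridiagonal.IsSharp A' As' →
      (Tridiagonal.PairIsomorphic A As A' As' ↔
        Tridiagonal.HaveCommonParameterArray A As A' As')) ∧
    (IsAlgClosed K →
      (∀ (A As : Module.End K V) (A' As' : Module.End K V'),
        Tridiagonal.IsTridiagonalPair A As → Tridiagonal.IsTridiagonalPair A' As' →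
        (Tridiagonal.PairIsomorphic A As A' As' ↔
          Tridiagonal.HaveCommonParameterArray A As A' As')) ∧
      (∀ (d d' : ℕ) (Φ : Tridiagonal.TridiagonalSystem K V d)
        (Φ' : Tridiagonal.TridiagonalSystem K V' d'),
        Φ.Isomorphic Φ' ↔ Φ.SameParameterArray Φ')) := by
  refine ⟨fun A As A' As' hp hp' hsharp _ =>
    Tridiagonal.pairIsomorphic_iff_of_isSharp hp hp' hsharp, fun _ =>
    ⟨fun A As A' As' hp hp' => Tridiagonal.pairIsomorphic_iff_of_isSharp hp hp' hp.isSharp,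
      fun d d' Φ Φ' => Φ.isomorphic_iff Φ'⟩⟩
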